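/- Let $d\ge 2$ be an integer and let $s\in(0,d)$ be a non-integer real number. Let $\varphi\in C^\infty([0,\infty))$ be non-negative and non-increasing, with (closed) support contained in $[0,2)$ and $\varphi\equiv 1$ on $[0,1)$. Let $\mu$ be a non-atomic locally finite Borel measure on $\mathbb{R}^d$. For $f\in L^2(\mu)$ put $$\mathcal{S}_\mu(f)(x)=\Bigl(\int_0^\infty\Bigl|\int_{\mathbb{R}^d}\frac{x-y}{t^{s+1}}\,\varphi\Bigl(\frac{|x-y|}{t}\Bigr)f(y)\,d\mu(y)\Bigr|^2\frac{dt}{t}\Bigr)^{1/2}\in[0,\infty],\qquad x\in\mathbb{R}^d.$$ Suppose that $\mathcal{S}_\mu$ is bounded in $L^2(\mu)$, that is, there is a finite constant $M$ with $\|\mathcal{S}_\mu(f)\|_{L^2(\mu)}\le M\|f\|_{L^2(\mu)}$ for every real-valued $f\in L^2(\mu)$. Then there is a constant $C\in(0,\infty)$ such that $$\mathcal{W}(\mu,Q):=\int_Q\int_0^\infty\Bigl(\frac{\mu(Q\cap B(x,r))}{r^s}\Bigr)^2\frac{dr}{r}\,d\mu(x)\le C\,\mu(Q)$$ for every open axis-parallel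 cube $Q\subset\mathbb{R}^d$ of positive side-length, where $B(x,r)$ denotes the open ball with centre $x$ and radius $r$. -/

import Mathlib

open MeasureTheory Set
open scoped ENNReal NNReal ContDiff

namespace SquareFunction

/-- Admissible bump functions: `φ ∈ C^∞([0,∞))` is non-negative and non-increasing, its (closed)
support is contained in `[0,2)`, and `φ ≡ 1` on `[0,1)`.  Only the values of `φ` on `[0,∞)`
matter. -/
structure IsBump (φ : ℝ → ℝ) : Prop where
  smooth : ContDiffOn ℝ ∞ φ (Ici 0)
  nonneg : ∀ t, 0 ≤ t → 0 ≤ φ t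
  antitone : AntitoneOn φ (Ici 0)
  support_subset : closure {t : ℝ | 0 ≤ t ∧ φ t ≠ 0} ⊆ Ico 0 2
  eq_one : ∀ t ∈ Ico (0 : ℝ) 1, φ t = 1

/-- The vector `∫ (x - y) / t^(s+1) φ(|x - y| / t) f(y) dμ(y)` of `ℝ^d`. -/
noncomputable def scaleIntegral {d : ℕ} (s : ℝ) (φ : ℝ → ℝ)
    (μ : Measure (EuclideanSpace ℝ (Fin d))) (f : EuclideanSpace ℝ (Fin d) → ℝ)
    (x : EuclideanSpace ℝ (Fin d)) (t : ℝ) : EuclideanSpace ℝ (Fin d) :=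
  ∫ y, (φ (‖x - y‖ / t) * f y / t ^ (s + 1)) • (x - y) ∂μ

/-- The square function
`S_μ(f)(x) = (∫_0^∞ |∫ (x - y) / t^(s+1) φ(|x - y| / t) f(y) dμ(y)|^2 dt/t)^(1/2)`,
with values in `[0,∞]`. -/
noncomputable def squareFunction {d : ℕ} (s : ℝ) (φ : ℝ → ℝ)
    (μ : Measure (EuclideanSpace ℝ (Fin d))) (f : EuclideanSpace ℝ (Fin d) → ℝ)
    (x : EuclideanSpace ℝ (Fin d)) : ℝ≥0∞ :=
  (∫⁻ t in Ioi (0 : ℝ), ‖scaleIntegral s φ μ f x t‖ₑ ^ 2 / ENNReal.ofReal t) ^ (1 / 2 : ℝ)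

/-- `S_μ` is bounded in `L²(μ)`: `‖S_μ(f)‖_{L²(μ)} ≤ M ‖f‖_{L²(μ)}` for all `f ∈ L²(μ)`, with a
finite constant `M`. -/
def SquareFunctionBounded {d : ℕ} (s : ℝ) (φ : ℝ → ℝ)
    (μ : Measure (EuclideanSpace ℝ (Fin d))) : Prop :=
  ∃ M : ℝ≥0, ∀ f : EuclideanSpace ℝ (Fin d) → ℝ, MemLp f 2 μ →
    eLpNorm (squareFunction s φ μ f) 2 μ ≤ (M : ℝ≥0∞) * eLpNorm f 2 μ

/-- The open axis-parallel cube with centre `c` and side-length `ℓ`. -/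
def cube {d : ℕ} (c : EuclideanSpace ℝ (Fin d)) (ℓ : ℝ) : Set (EuclideanSpace ℝ (Fin d)) :=
  {x | ∀ i, |x i - c i| < ℓ / 2}

/-- The Wolff energy
`W(μ, Q) = ∫_Q ∫_0^∞ (μ(Q ∩ B(x,r)) / r^s)^2 dr/r dμ(x)`, with values in `[0,∞]`. -/
noncomputable def wolffEnergy {d : ℕ} (s : ℝ) (μ : Measure (EuclideanSpace ℝ (Fin d)))
    (Q : Set (EuclideanSpace ℝ (Fin d))) : ℝ≥0∞ :=
  ∫⁻ x in Q, (∫⁻ r in Ioi (0 : ℝ),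
    (μ (Q ∩ Metric.ball x r) / ENNReal.ofReal (r ^ s)) ^ 2 / ENNReal.ofReal r) ∂μ

end SquareFunction

/-! ### Radial cutoffs and the vector field they generate. -/

namespace SquareFunction

/-! Write `ν = μ|_Q` and `K = ⌈s⌉`; since `s` is not an integer, `K - 1 < s < K`. Testing the square
function on the indicator of a bounded set `B` bounds `energy` of `μ|_B` by `M² μ(B)`. Two things
follow from this.

Power growth, `μ(B(x,r)) ≤ A r^s` (`IsProfile.exists_growth`). At scales `t ≥ 2r` the cutoff is `1`
on the whole ball, so the flux is the mass times the displacement from the barycentre, divided by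
`t`. A ball whose mass is large compared with `r^s` must therefore keep most of it in a ball of half
the radius. The condition improves under iteration, the losses are summable, and the limit of the
centres would be an atom.

A pointwise inequality (`IsProfile.exists_density_sq_le`): the squared density of a ball is at most
a quarter of the squared density at scale `Tr`, plus a small multiple of the average squared density
at scale `lam * r`, plus a multiple of the average energy over the scales in `(r, Tr]`. There are
three cases. (1) If the mass of `B(x,Tr)` exceeds `2 T^s` times that of `B(x,r)`, the first term
suffices. (2) If half the mass lies near a plane of dimension at most `K - 1 < s`, a fine grid has
so few cells meeting it that the average density at the grid scale is large. (3) Otherwise the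
energy is large (`IsProfile.exists_energy_lower_bound`). If not, the flux would be small on a set
spanning `K` directions quantitatively. The linearized flux is then small along these directions,
and so is its trace there. That trace dominates, up to powers of `t`, minus the `t`-derivative of
`t^(-K)` times the mollified mass of `B(x,t)`. The mass would then grow almost like `t^K`, and `s <
K` contradicts the failure of (1).

Integrating over all centres and over scales above `a > 0`, averages over balls cost only a
dimensional constant (`lintegral_average_ball_le`), and power growth pays for the scales in `(lam *
a, a]`. The truncated Wolff energy is finite, so half of it can be absorbed. Then let `a` tend to
`0`. -/

/-- A radial cutoff, as a function of the squared distance. -/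
structure IsProfile (g : ℝ → ℝ) : Prop where
  smooth : ContDiff ℝ ∞ g
  nonneg : ∀ q, 0 ≤ g q
  antitone : Antitone g
  eq_one : ∀ q, q < 1 → g q = 1
  eq_zero : ∀ q, 4 ≤ q → g q = 0

/-- The square root is singular only at `0`, and there the composition is locally constant because
`φ ≡ 1` on `[0,1)`. -/
theorem IsBump.isProfile {φ : ℝ → ℝ} (hφ : IsBump φ) : IsProfile (fun q => φ (√q)) where
  smooth := by
    rw [contDiff_iff_contDiffAt]
    intro q
    rcases lt_or_ge q 1 with h | h
    · have : (fun q => φ (√q)) =ᶠ[nhds q] fun _ => 1 := by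
        filter_upwards [Iio_mem_nhds h] with x hx
        exact hφ.eq_one _ ⟨Real.sqrt_nonneg _, by
          rw [Real.sqrt_lt' one_pos]; simpa using hx⟩
      exact contDiffAt_const.congr_of_eventuallyEq this
    · have hq : 0 < q := by linarith
      have h1 : ContDiffAt ℝ ∞ φ (√q) :=
        hφ.smooth.contDiffAt (Ici_mem_nhds (Real.sqrt_pos.2 hq))
      exact h1.comp q (Real.contDiffAt_sqrt hq.ne')
  nonneg q := hφ.nonneg _ (Real.sqrt_nonneg _)
  antitone a b h := hφ.antitone (Real.sqrt_nonneg _) (Real.sqrt_nonneg _) (Real.sqrt_le_sqrt h)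
  eq_one q h := hφ.eq_one _ ⟨Real.sqrt_nonneg _, by
    rw [Real.sqrt_lt' one_pos]; simpa using h⟩
  eq_zero q h := by
    by_contra h0
    have := (hφ.support_subset (subset_closure ⟨Real.sqrt_nonneg q, h0⟩)).2
    rw [Real.sqrt_lt' two_pos] at this
    linarith

variable {E : Type*} [NormedAddCommGroup E] [InnerProductSpace ℝ E]

/-- The vector field `u ↦ g(|u|²) u`. -/
def field (g : ℝ → ℝ) (u : E) : E := g (‖u‖ ^ 2) • u

namespace IsProfile

variable {g : ℝ → ℝ} (hg : IsProfile g)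
include hg

theorem le_one (q : ℝ) : g q ≤ 1 := by
  rw [← hg.eq_one (min q 0) (by simp)]
  exact hg.antitone (min_le_left _ _)

theorem deriv_nonpos (q : ℝ) : deriv g q ≤ 0 := hg.antitone.deriv_nonpos

theorem field_eq_zero {u : E} (hu : 2 ≤ ‖u‖) : field g u = 0 := by
  rw [field, hg.eq_zero _ (by nlinarith), zero_smul]

theorem norm_field_le (u : E) : ‖field g u‖ ≤ 2 := by
  rcases le_or_gt 2 ‖u‖ with h | h
  · rw [hg.field_eq_zero h]; simp
  · rw [field, norm_smul, Real.norm_of_nonneg (hg.nonneg _)]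
    nlinarith [hg.le_one (‖u‖ ^ 2), hg.nonneg (‖u‖ ^ 2), norm_nonneg u]

theorem contDiff_field : ContDiff ℝ ∞ (field g : E → E) :=
  (hg.smooth.comp (contDiff_norm_sq ℝ)).smul contDiff_id

theorem continuous_field : Continuous (field g : E → E) := hg.contDiff_field.continuous

theorem fderiv_field (u v : E) :
    fderiv ℝ (field g) u v = g (‖u‖ ^ 2) • v + (2 * deriv g (‖u‖ ^ 2) * inner ℝ u v) • u := by
  have h1 : HasDerivAt g (deriv g (‖u‖ ^ 2)) (‖u‖ ^ 2) :=
    (hg.smooth.differentiable (by simp)).differentiableAt.hasDerivAt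
  have h2 : HasFDerivAt (fun u : E => ‖u‖ ^ 2) (2 • innerSL ℝ u) u :=
    (hasStrictFDerivAt_norm_sq u).hasFDerivAt
  have h3 := (h1.comp_hasFDerivAt u h2).smul (hasFDerivAt_id u)
  have h4 : HasFDerivAt (field g) _ u := h3
  rw [h4.fderiv]
  simp
  congr 1
  ring

theorem hasCompactSupport_field [FiniteDimensional ℝ E] :
    HasCompactSupport (field g : E → E) := by
  refine HasCompactSupport.of_support_subset_isCompact (isCompact_closedBall (0 : E) 2) ?_
  intro u hu
  by_contra h
  simp only [Metric.mem_closedBall, dist_zero_right, not_le] at h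
  exact hu (hg.field_eq_zero h.le)

theorem contDiff_fderiv_field : ContDiff ℝ 1 (fderiv ℝ (field g : E → E)) :=
  hg.contDiff_field.fderiv_right (m := 1) (by rw [one_add_one_eq_two]; exact ENat.LEInfty.out)

theorem exists_lipschitz [FiniteDimensional ℝ E] :
    ∃ C : ℝ≥0, LipschitzWith C (fderiv ℝ (field g : E → E)) :=
  hg.contDiff_fderiv_field.lipschitzWith_of_hasCompactSupport
    (hg.hasCompactSupport_field.fderiv ℝ) one_ne_zero

/-- The derivative is Lipschitz, being `C¹` with compact support; apply the mean value inequality on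
the segment from `u` to `u + v`. -/
theorem exists_taylor [FiniteDimensional ℝ E] : ∃ C : ℝ, 0 ≤ C ∧ ∀ u v : E,
    ‖field g (u + v) - field g u - fderiv ℝ (field g) u v‖ ≤ C * ‖v‖ ^ 2 := by
  obtain ⟨C, hC⟩ := hg.exists_lipschitz (E := E)
  refine ⟨C, C.2, fun u v => ?_⟩
  have h2 := (convex_segment u (u + v)).norm_image_sub_le_of_norm_fderiv_le' (𝕜 := ℝ)
    (f := field g) (φ := fderiv ℝ (field g) u) (C := C * ‖v‖)
    (fun x _ => (hg.contDiff_field.differentiable (by simp)).differentiableAt)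
    (fun x hx => ?_) (left_mem_segment ℝ _ _) (right_mem_segment ℝ _ _)
  · rw [add_sub_cancel_left] at h2
    rw [pow_two, ← mul_assoc]
    exact h2
  · rw [← dist_eq_norm]
    refine (hC.dist_le_mul _ _).trans ?_
    gcongr
    rw [dist_eq_norm]
    rw [segment_eq_image'] at hx
    obtain ⟨t, ⟨h0, h1⟩, rfl⟩ := hx
    rw [add_sub_cancel_left, add_sub_cancel_left, norm_smul, Real.norm_of_nonneg h0]
    exact mul_le_of_le_one_left (norm_nonneg v) h1

/-- Both `u` and `u + v` are off the support. After rescaling, this confines the Taylor error of the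
flux to the mass of `B(x,4t)`. -/
theorem taylor_eq_zero {u v : E} (hu : 4 ≤ ‖u‖) (hv : ‖v‖ ≤ 2) :
    field g (u + v) - field g u - fderiv ℝ (field g) u v = 0 := by
  have h1 : 2 ≤ ‖u + v‖ := by
    have := norm_sub_le (u + v) v
    rw [add_sub_cancel_right] at this
    linarith
  have h2 : field g =ᶠ[nhds u] fun _ : E => 0 := by
    filter_upwards [(isOpen_lt continuous_const continuous_norm).mem_nhds
      (show (2 : ℝ) < ‖u‖ by linarith)] with x hx
    exact hg.field_eq_zero (le_of_lt hx)
  rw [hg.field_eq_zero h1, hg.field_eq_zero (by linarith : 2 ≤ ‖u‖), h2.fderiv_eq]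
  simp

/-- The partial trace contains `2g'` times the squared projection of `u`. Since `g' ≤ 0`, Bessel's
inequality allows that projection to be replaced by `|u|²`. The resulting radial expression is, up
to a factor, the scale derivative computed in `hasDerivAt_div_pow`. -/
theorem le_sum_inner_fderiv {k : ℕ} {e : Fin k → E} (he : Orthonormal ℝ e) (u : E) :
    k * g (‖u‖ ^ 2) + 2 * deriv g (‖u‖ ^ 2) * ‖u‖ ^ 2 ≤
      ∑ i, inner ℝ (fderiv ℝ (field g) u (e i)) (e i) := by
  have h1 : ∀ i, inner ℝ (fderiv ℝ (field g) u (e i)) (e i) =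
      g (‖u‖ ^ 2) + 2 * deriv g (‖u‖ ^ 2) * ‖inner ℝ (e i) u‖ ^ 2 := by
    intro i
    rw [hg.fderiv_field, inner_add_left, real_inner_smul_left, real_inner_smul_left,
      real_inner_self_eq_norm_sq, he.1 i, Real.norm_eq_abs, sq_abs, real_inner_comm u (e i)]
    ring
  simp_rw [h1]
  rw [Finset.sum_add_distrib, ← Finset.mul_sum]
  have h2 := he.sum_inner_products_le (x := u) (s := Finset.univ)
  have h3 := hg.deriv_nonpos (‖u‖ ^ 2)
  simp only [Finset.sum_const, Finset.card_univ, Fintype.card_fin, nsmul_eq_mul]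
  nlinarith

end IsProfile

end SquareFunction

/-! ### The energy of restrictions of the measure. -/

namespace SquareFunction

section

variable {E : Type*} [NormedAddCommGroup E] [InnerProductSpace ℝ E] [MeasurableSpace E]

/-- The rescaled kernel integral `∫ g(|x - y|² / t²) (x - y) / t dν(y)`. -/
noncomputable def flux (g : ℝ → ℝ) (ν : Measure E) (t : ℝ) (x : E) : E :=
  ∫ y, field g (t⁻¹ • (x - y)) ∂ν

/-- The squared `L²(ν)` norm of the square function of the constant function `1`. -/
noncomputable def energy (g : ℝ → ℝ) (s : ℝ) (ν : Measure E) : ℝ≥0∞ :=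
  ∫⁻ x, (∫⁻ t in Ioi (0 : ℝ), ‖flux g ν t x‖ₑ ^ 2 * ENNReal.ofReal (t ^ (-2 * s - 1))) ∂ν

theorem IsProfile.norm_flux_le {g : ℝ → ℝ} (hg : IsProfile g) (ν : Measure E)
    [IsFiniteMeasure ν] (t : ℝ) (x : E) :
    ‖flux g ν t x‖ ≤ 2 * ν.real univ :=
  norm_integral_le_of_norm_le_const (ae_of_all _ fun _ => hg.norm_field_le _)

end

section

variable {d : ℕ} {s : ℝ} {φ : ℝ → ℝ} {μ : Measure (EuclideanSpace ℝ (Fin d))}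

theorem scaleIntegral_indicator {B : Set (EuclideanSpace ℝ (Fin d))} (hB : MeasurableSet B)
    (x : EuclideanSpace ℝ (Fin d)) {t : ℝ} (ht : 0 < t) :
    scaleIntegral s φ μ (B.indicator fun _ => 1) x t =
      t ^ (-s) • flux (fun q => φ (√q)) (μ.restrict B) t x := by
  rw [scaleIntegral, flux, ← integral_smul, ← integral_indicator hB]
  congr 1
  ext1 y
  by_cases hy : y ∈ B
  · simp only [indicator_of_mem hy, field, smul_smul]
    rw [Real.sqrt_sq (norm_nonneg _), norm_smul, norm_inv, Real.norm_of_nonneg ht.le,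
      inv_mul_eq_div, mul_one, Real.rpow_add ht, Real.rpow_one, Real.rpow_neg ht.le]
    congr 1
    field_simp
  · simp [indicator_of_notMem hy]

/-- Test on the indicator of `B`, and keep only the points of `B` in the outer integral. -/
theorem energy_restrict_le {M : ℝ≥0}
    (hM : ∀ f : EuclideanSpace ℝ (Fin d) → ℝ, MemLp f 2 μ →
      eLpNorm (squareFunction s φ μ f) 2 μ ≤ (M : ℝ≥0∞) * eLpNorm f 2 μ)
    {B : Set (EuclideanSpace ℝ (Fin d))} (hB : MeasurableSet B) (hB' : μ B ≠ ⊤) :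
    energy (fun q => φ (√q)) s (μ.restrict B) ≤ (M : ℝ≥0∞) ^ 2 * μ B := by
  have h1 := hM _ (memLp_indicator_const 2 hB (1 : ℝ) (Or.inr hB'))
  rw [eLpNorm_indicator_const hB (by simp) (by simp),
    eLpNorm_eq_lintegral_rpow_enorm_toReal (by simp) (by simp)] at h1
  have h2 := ENNReal.rpow_le_rpow h1 (z := 2) (by norm_num)
  rw [← ENNReal.rpow_mul, ENNReal.mul_rpow_of_nonneg _ _ (by norm_num),
    ENNReal.mul_rpow_of_nonneg _ _ (by norm_num), ← ENNReal.rpow_mul] at h2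
  simp only [ENNReal.toReal_ofNat, one_div, ne_eq, OfNat.ofNat_ne_zero, not_false_eq_true,
    inv_mul_cancel₀, ENNReal.rpow_one, enorm_one, ENNReal.one_rpow, one_mul, enorm_eq_self] at h2
  rw [ENNReal.rpow_ofNat] at h2
  refine le_trans ?_ h2
  refine (lintegral_mono' Measure.restrict_le_self le_rfl).trans (lintegral_mono fun x => ?_)
  rw [squareFunction, ← ENNReal.rpow_mul]
  norm_num
  refine setLIntegral_mono' measurableSet_Ioi fun t ht => ?_
  have ht : 0 < t := ht
  rw [scaleIntegral_indicator hB x ht, enorm_smul, mul_pow, Real.enorm_of_nonneg (by positivity),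
    ← ENNReal.ofReal_pow (by positivity), ENNReal.div_eq_inv_mul,
    ← ENNReal.ofReal_inv_of_pos ht, ← mul_assoc, ← ENNReal.ofReal_mul (by positivity), mul_comm]
  gcongr
  rw [← Real.rpow_natCast (t ^ (-s)), ← Real.rpow_mul ht.le, ← Real.rpow_neg_one,
    ← Real.rpow_add ht]
  apply le_of_eq
  congr 1
  push_cast
  ring

end

/-! ### Power growth of the measure. -/

section

variable {E : Type*} [NormedAddCommGroup E] [InnerProductSpace ℝ E] [FiniteDimensional ℝ E]
  [MeasurableSpace E] [BorelSpace E]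

/-- Points of the ball are at distance less than `2r ≤ t`, so the cutoff is identically `1` and the
kernel is linear in `y`: only the barycentre survives. -/
theorem IsProfile.flux_of_ball {g : ℝ → ℝ} (hg : IsProfile g) {μ : Measure E}
    [IsLocallyFiniteMeasure μ] {x : E} {r : ℝ} {t : ℝ} (ht : 2 * r ≤ t) (hr : 0 < r) {z : E}
    (hz : z ∈ Metric.ball x r) :
    flux g (μ.restrict (Metric.ball x r)) t z =
      (t⁻¹ * μ.real (Metric.ball x r)) • (z - ⨍ y in Metric.ball x r, y ∂μ) := by
  have ht0 : 0 < t := by linarith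
  have hfin : μ (Metric.ball x r) ≠ ⊤ := measure_ball_lt_top.ne
  have hint : IntegrableOn (fun y : E => y) (Metric.ball x r) μ := by
    refine Measure.integrableOn_of_bounded (M := ‖x‖ + r) hfin
      measurable_id.aestronglyMeasurable ?_
    filter_upwards [ae_restrict_mem Metric.isOpen_ball.measurableSet] with y hy
    rw [mem_ball_iff_norm] at hy
    have := norm_le_norm_add_norm_sub x y
    rw [norm_sub_rev] at hy
    linarith [norm_sub_rev x y]
  have h1 : flux g (μ.restrict (Metric.ball x r)) t z =
      ∫ y in Metric.ball x r, t⁻¹ • (z - y) ∂μ := by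
    refine setIntegral_congr_fun Metric.isOpen_ball.measurableSet fun y hy => ?_
    rw [field, hg.eq_one, one_smul]
    rw [norm_smul, norm_inv, Real.norm_of_nonneg ht0.le, inv_mul_eq_div, ← dist_eq_norm]
    have h2 : dist z y < t := by
      have := dist_triangle_right z y x
      rw [Metric.mem_ball] at hy hz
      linarith
    rw [sq_lt_one_iff₀ (by positivity), div_lt_one ht0]
    exact h2
  rw [h1, integral_smul, integral_sub (integrableOn_const hfin : IntegrableOn (fun _ : E => z) _ μ) hint,
    setIntegral_const,
    setAverage_eq, mul_smul, smul_sub, smul_smul]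
  rcases eq_or_ne (μ.real (Metric.ball x r)) 0 with h | h
  · have h3 : μ.restrict (Metric.ball x r) = 0 := by
      rw [Measure.restrict_eq_zero]
      exact (measureReal_eq_zero_iff hfin).1 h
    simp [h, h3]
  · rw [mul_smul t⁻¹, smul_sub (μ.real (Metric.ball x r)), smul_smul (μ.real (Metric.ball x r)),
      mul_inv_cancel₀ h, one_smul, smul_sub]

/-- A ball whose restricted measure has small energy carries most of its mass in a ball of half
the radius. -/
theorem IsProfile.exists_concentration {g : ℝ → ℝ} (hg : IsProfile g) {s : ℝ} (hs : 0 < s)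
    {μ : Measure E} [IsLocallyFiniteMeasure μ] {M : ℝ≥0}
    (hM : ∀ (x : E) (r : ℝ), energy g s (μ.restrict (Metric.ball x r)) ≤
      (M : ℝ≥0∞) ^ 2 * μ (Metric.ball x r)) {x : E} {r : ℝ} (hr : 0 < r) :
    ∃ c : E, μ.real (Metric.ball x r) * μ.real (Metric.ball x r \ Metric.ball c (r / 2)) ≤
      32 * 4 ^ (2 * s + 1) * M ^ 2 * r ^ (2 * s) := by
  have hfin : μ (Metric.ball x r) ≠ ⊤ := measure_ball_lt_top.ne
  set B := Metric.ball x r with hB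
  have hBm : MeasurableSet B := Metric.isOpen_ball.measurableSet
  set m := μ.real B with hm
  set c := ⨍ y in B, y ∂μ with hc
  refine ⟨c, ?_⟩
  set A := B \ Metric.ball c (r / 2) with hA
  have hAm : MeasurableSet A := hBm.diff Metric.isOpen_ball.measurableSet
  have hAB : A ⊆ B := sdiff_subset
  -- Use only the scales `t ∈ (2r, 4r]`. For points at distance at least `r/2` from the barycentre
  -- the flux has norm at least `m (r/2) / (4r) = m/8`.
  have key : ENNReal.ofReal ((m / 8) ^ 2 * (4 * r) ^ (-2 * s - 1) * (2 * r)) * μ A ≤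
      (M : ℝ≥0∞) ^ 2 * μ B := by
    refine le_trans ?_ (hM x r)
    rw [energy, ← setLIntegral_const]
    refine le_trans ?_ (lintegral_mono' (Measure.restrict_mono_set μ hAB) le_rfl)
    refine setLIntegral_mono' hAm fun z hz => ?_
    have hsub : Ioc (2 * r) (4 * r) ⊆ Ioi (0 : ℝ) := fun t ht => by
      have := ht.1
      simp only [mem_Ioi]
      linarith
    refine le_trans ?_ (lintegral_mono_set hsub)
    have : ENNReal.ofReal ((m / 8) ^ 2 * (4 * r) ^ (-2 * s - 1) * (2 * r)) =
        ∫⁻ _ in Ioc (2 * r) (4 * r), ENNReal.ofReal ((m / 8) ^ 2 * (4 * r) ^ (-2 * s - 1)) := by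
      rw [setLIntegral_const, Real.volume_Ioc, ← ENNReal.ofReal_mul (by positivity)]
      congr 2
      ring
    rw [this]
    refine setLIntegral_mono' measurableSet_Ioc fun t ht => ?_
    have ht0 : 0 < t := hsub ht
    rw [hg.flux_of_ball ht.1.le hr (hAB hz), ← ofReal_norm,
      ← ENNReal.ofReal_pow (norm_nonneg _), ← ENNReal.ofReal_mul (by positivity)]
    refine ENNReal.ofReal_le_ofReal ?_
    have hzc : r / 2 ≤ ‖z - c‖ := by
      have := hz.2
      rwa [mem_ball_iff_norm, not_lt] at this
    gcongr ?_ ^ 2 * ?_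
    · rw [norm_smul, Real.norm_of_nonneg (by positivity)]
      have h4 : (4 * r)⁻¹ ≤ t⁻¹ := by
        gcongr
        exact ht.2
      calc m / 8 = (4 * r)⁻¹ * m * (r / 2) := by field_simp; ring
        _ ≤ _ := by gcongr
    · exact Real.rpow_le_rpow_of_nonpos ht0 ht.2 (by linarith)
  have hAfin : μ A ≠ ⊤ := measure_ne_top_of_subset hAB hfin
  have key2 := ENNReal.toReal_mono (by finiteness) key
  rw [ENNReal.toReal_mul, ENNReal.toReal_ofReal (by positivity), ENNReal.toReal_mul] at key2
  simp only [ENNReal.toReal_pow, ENNReal.coe_toReal] at key2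
  change _ * μ.real A ≤ _ * m at key2
  rcases eq_or_lt_of_le (measureReal_nonneg : 0 ≤ m) with h0 | h0
  · have : m = 0 := h0.symm
    rw [this, zero_mul]
    positivity
  · have e1 : (4 * r) ^ (-2 * s - 1) * (4 * 4 ^ (2 * s) * (r * r ^ (2 * s))) = 1 := by
      have : (4 : ℝ) * 4 ^ (2 * s) * (r * r ^ (2 * s)) = (4 * r) ^ (2 * s + 1) := by
        rw [Real.mul_rpow (by norm_num) hr.le, Real.rpow_add hr, Real.rpow_add (by norm_num)]
        simp; ring
      rw [this, ← Real.rpow_add (by positivity)]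
      ring_nf
      simp
    have e2 : (4 : ℝ) ^ (2 * s + 1) = 4 * 4 ^ (2 * s) := by
      rw [Real.rpow_add (by norm_num)]; simp; ring
    rw [e2]
    have h5 : 0 < (4 * r) ^ (-2 * s - 1) := by positivity
    set X := (4 * r) ^ (-2 * s - 1)
    set R := r ^ (2 * s)
    set F := (4 : ℝ) ^ (2 * s)
    have h6 : (m * X * r / 32) * (m * μ.real A) ≤ (m * X * r / 32) * (32 * (4 * F) * M ^ 2 * R) := by
      calc _ = (m / 8) ^ 2 * X * (2 * r) * μ.real A := by ring
        _ ≤ M ^ 2 * m := key2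
        _ = M ^ 2 * m * (X * (4 * F * (r * R))) := by rw [e1, mul_one]
        _ = _ := by ring
    exact le_of_mul_le_mul_left h6 (by positivity)

/-- Bounded energy on balls forces power growth of a non-atomic measure. -/
theorem IsProfile.exists_growth {g : ℝ → ℝ} (hg : IsProfile g) {s : ℝ} (hs : 0 < s)
    {μ : Measure E} [IsLocallyFiniteMeasure μ] [NullSingletonClass μ] {M : ℝ≥0}
    (hM : ∀ (x : E) (r : ℝ), energy g s (μ.restrict (Metric.ball x r)) ≤
      (M : ℝ≥0∞) ^ 2 * μ (Metric.ball x r)) :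
    ∃ A : ℝ, 0 < A ∧ ∀ (x : E) (r : ℝ), 0 < r → μ.real (Metric.ball x r) ≤ A * r ^ s := by
  set D : ℝ := 32 * 4 ^ (2 * s + 1) * M ^ 2 with hD
  have hD0 : 0 ≤ D := by positivity
  set q : ℝ := (1 / 4) ^ s with hq
  have hq0 : 0 < q := by positivity
  have hq1 : q < 1 := Real.rpow_lt_one (by norm_num) (by norm_num) hs
  -- Chosen so that a violation gives `4 D r^(2s) ≤ m₀² (1 - q)`, which makes the losses over all
  -- scales sum to at most `m₀/2`. The `+ 1` keeps the constant positive when `D = 0`.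
  refine ⟨√(4 * D / (1 - q) + 1), Real.sqrt_pos.2 ?_, fun x r hr => ?_⟩
  · have : 0 ≤ 4 * D / (1 - q) := div_nonneg (by positivity) (by linarith)
    linarith
  by_contra! hcon
  have hfin : ∀ (x : E) (r : ℝ), μ (Metric.ball x r) ≠ ⊤ := fun _ _ => measure_ball_lt_top.ne
  set m₀ := μ.real (Metric.ball x r) with hm₀
  have hA0 : 0 ≤ √(4 * D / (1 - q) + 1) * r ^ s := by positivity
  have hm₀pos : 0 < m₀ := hA0.trans_lt hcon
  have hbig : 4 * D * r ^ (2 * s) ≤ m₀ ^ 2 * (1 - q) := by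
    have h1 : (√(4 * D / (1 - q) + 1) * r ^ s) ^ 2 ≤ m₀ ^ 2 := by gcongr
    have h2 : 0 ≤ 4 * D / (1 - q) := div_nonneg (by positivity) (by linarith)
    rw [mul_pow, Real.sq_sqrt (by linarith), ← Real.rpow_natCast, ← Real.rpow_mul hr.le] at h1
    have h3 : r ^ (s * (2 : ℕ)) = r ^ (2 * s) := by congr 1; push_cast; ring
    rw [h3] at h1
    have h4 : 4 * D / (1 - q) * r ^ (2 * s) ≤ m₀ ^ 2 := by
      nlinarith [Real.rpow_pos_of_pos hr (2 * s)]
    have h5 : 0 < 1 - q := by linarith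
    rw [div_mul_eq_mul_div, div_le_iff₀ h5] at h4
    exact h4
  choose c hc using fun (x : E) (r : ℝ) (hr : 0 < r) => hg.exists_concentration hs hM (x := x) hr
  let ρ : ℕ → ℝ := fun n => r * (1 / 2) ^ n
  have hρ : ∀ n, 0 < ρ n := fun n => by positivity
  have hρs : ∀ n, ρ n ^ (2 * s) = r ^ (2 * s) * q ^ n := fun n => by
    rw [Real.mul_rpow hr.le (by positivity), ← Real.rpow_natCast, ← Real.rpow_natCast q,
      ← Real.rpow_mul (by norm_num), hq, ← Real.rpow_mul (by norm_num),
      show (1 / 4 : ℝ) = (1 / 2) ^ (2 : ℝ) by norm_num, ← Real.rpow_mul (by norm_num)]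
    congr 2
    ring
  let X : ℕ → E := fun n => Nat.rec x (fun j y => c y (ρ j) (hρ j)) n
  have hX : ∀ n, X (n + 1) = c (X n) (ρ n) (hρ n) := fun n => rfl
  -- The loss at step `n` is at most `(m₀/2)(q^n - q^(n+1))`, so the sum telescopes. Bounding the
  -- mass of the intersection also shows that consecutive balls meet, which controls the distance of
  -- their centres.
  have hstep : ∀ n, m₀ / 2 * (1 + q ^ n) ≤ μ.real (Metric.ball (X n) (ρ n)) →
      m₀ / 2 * (1 + q ^ (n + 1)) ≤
        μ.real (Metric.ball (X n) (ρ n) ∩ Metric.ball (X (n + 1)) (ρ (n + 1))) := by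
    intro n hn
    have h1 := hc (X n) (ρ n) (hρ n)
    rw [← hX, ← hD, hρs] at h1
    have h2 : ρ n / 2 = ρ (n + 1) := by simp only [ρ]; ring
    rw [h2] at h1
    have h3 := measureReal_inter_add_sdiff (μ := μ) (s := Metric.ball (X n) (ρ n))
      (t := Metric.ball (X (n + 1)) (ρ (n + 1))) Metric.isOpen_ball.measurableSet (hfin _ _)
    set a := μ.real (Metric.ball (X n) (ρ n))
    set b := μ.real (Metric.ball (X n) (ρ n) \ Metric.ball (X (n + 1)) (ρ (n + 1)))
    have hb : 0 ≤ b := measureReal_nonneg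
    have hqn : 0 < q ^ n := by positivity
    have h4 : m₀ / 2 * b ≤ m₀ / 2 * (m₀ / 2 * (q ^ n - q ^ (n + 1))) := by
      calc m₀ / 2 * b ≤ a * b := by
            gcongr
            nlinarith
        _ ≤ D * (r ^ (2 * s) * q ^ n) := h1
        _ = (4 * D * r ^ (2 * s)) * q ^ n / 4 := by ring
        _ ≤ (m₀ ^ 2 * (1 - q)) * q ^ n / 4 := by gcongr
        _ = _ := by ring
    have h5 := le_of_mul_le_mul_left h4 (by positivity)
    linarith
  have hmass : ∀ n, m₀ / 2 * (1 + q ^ n) ≤ μ.real (Metric.ball (X n) (ρ n)) := by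
    intro n
    induction n with
    | zero =>
      have : Metric.ball (X 0) (ρ 0) = Metric.ball x r := by simp [X, ρ]
      rw [this, ← hm₀]
      simp
      linarith
    | succ n ih =>
      exact (hstep n ih).trans (measureReal_mono inter_subset_right (hfin _ _))
  have hdist : ∀ n, dist (X n) (X (n + 1)) ≤ 2 * r * (1 / 2) ^ n := by
    intro n
    have h1 : 0 < μ.real (Metric.ball (X n) (ρ n) ∩ Metric.ball (X (n + 1)) (ρ (n + 1))) :=
      lt_of_lt_of_le (by positivity) (hstep n (hmass n))
    obtain ⟨y, hy1, hy2⟩ := nonempty_of_measureReal_ne_zero h1.ne'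
    rw [Metric.mem_ball'] at hy1
    rw [Metric.mem_ball] at hy2
    have h2 : ρ (n + 1) = ρ n / 2 := by simp only [ρ]; ring
    have h3 : 2 * r * (1 / 2) ^ n = 2 * ρ n := by simp only [ρ]; ring
    have := dist_triangle (X n) y (X (n + 1))
    linarith [hρ n]
  obtain ⟨a, ha⟩ := cauchySeq_tendsto_of_complete
    (cauchySeq_of_le_geometric (1 / 2) (2 * r) (by norm_num) hdist)
  have hda := dist_le_of_le_geometric_of_tendsto (1 / 2) (2 * r) (by norm_num) hdist ha
  -- Outer regularity at the null singleton `{a}`; the balls of the sequence shrink to `a` and have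
  -- mass at least `m₀/2`.
  obtain ⟨U, haU, hUo, hU⟩ := Set.exists_isOpen_lt_of_lt (μ := μ) {a} (ENNReal.ofReal (m₀ / 2))
    (by rw [measure_singleton]; exact ENNReal.ofReal_pos.2 (by positivity))
  obtain ⟨ε, hε, hεU⟩ := Metric.isOpen_iff.1 hUo a (haU rfl)
  obtain ⟨n, hn⟩ := exists_pow_lt_of_lt_one (show 0 < ε / (5 * r) by positivity)
    (show (1 / 2 : ℝ) < 1 by norm_num)
  have hsub : Metric.ball (X n) (ρ n) ⊆ U := by
    refine Subset.trans (fun y hy => ?_) hεU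
    rw [Metric.mem_ball] at hy ⊢
    rw [lt_div_iff₀ (by positivity)] at hn
    have h1 := hda n
    have h2 := dist_triangle y (X n) a
    have h3 : 2 * r * (1 / 2) ^ n / (1 - 1 / 2) = 4 * ρ n := by simp only [ρ]; ring
    have h4 : (1 / 2) ^ n * (5 * r) = 5 * ρ n := by simp only [ρ]; ring
    linarith
  have h1 : ENNReal.ofReal (m₀ / 2) ≤ μ (Metric.ball (X n) (ρ n)) := by
    rw [← ofReal_measureReal (hfin _ _)]
    refine ENNReal.ofReal_le_ofReal (le_trans ?_ (hmass n))
    have : 0 < q ^ n := by positivity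
    nlinarith
  exact absurd (h1.trans (measure_mono hsub)) (not_le.2 hU)

end
end SquareFunction

/-! ### Grids and averages over balls. -/

namespace SquareFunction

section

variable {E : Type*} [NormedAddCommGroup E] [InnerProductSpace ℝ E]

/-- The index of the cell of side `η` containing `y`, in the coordinates given by `e` with
origin `p`. -/
noncomputable def cell {j : ℕ} (e : Fin j → E) (p : E) (η : ℝ) (y : E) : Fin j → ℤ :=
  fun i => ⌊inner ℝ (e i) (y - p) / η⌋

/-- The cells of side `r / n` that meet a ball of radius `r`. -/
noncomputable def cellRange (j n : ℕ) : Finset (Fin j → ℤ) :=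
  Fintype.piFinset fun _ => Finset.Icc (-(n : ℤ)) n

theorem card_cellRange (j n : ℕ) : (cellRange j n).card = (2 * n + 1) ^ j := by
  simp only [cellRange, Fintype.card_piFinset, Int.card_Icc, Finset.prod_const, Finset.card_univ,
    Fintype.card_fin]
  congr 1
  omega

theorem cell_mem {j n : ℕ} (hn : 0 < n) {e : Fin j → E} (he : ∀ i, ‖e i‖ = 1) {p y : E} {r : ℝ}
    (hr : 0 < r) (hy : y ∈ Metric.ball p r) : cell e p (r / n) y ∈ cellRange j n := by
  simp only [cellRange, Fintype.mem_piFinset, Finset.mem_Icc, cell]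
  intro i
  have hn' : (0 : ℝ) < n := by exact_mod_cast hn
  have h1 : |inner ℝ (e i) (y - p)| ≤ r := by
    refine (abs_real_inner_le_norm _ _).trans ?_
    rw [he, one_mul, ← dist_eq_norm]
    exact (Metric.mem_ball.1 hy).le
  have h2 : |inner ℝ (e i) (y - p) / (r / n)| ≤ n := by
    rw [abs_div, abs_of_pos (show 0 < r / n by positivity), div_le_iff₀ (by positivity)]
    calc _ ≤ r := h1
      _ = _ := by field_simp
  rw [abs_le] at h2
  constructor
  · rw [Int.le_floor]
    push_cast
    exact h2.1
  · have : ((⌊inner ℝ (e i) (y - p) / (r / n)⌋ : ℤ) : ℝ) ≤ ((n : ℤ) : ℝ) := by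
      push_cast
      exact (Int.floor_le _).trans h2.2
    exact_mod_cast this

theorem abs_inner_sub_lt_of_cell_eq {j : ℕ} {e : Fin j → E} {p y z : E} {η : ℝ} (hη : 0 < η)
    (h : cell e p η y = cell e p η z) (i : Fin j) : |inner ℝ (e i) (y - z)| < η := by
  have h1 := Int.abs_sub_lt_one_of_floor_eq_floor (congrFun h i)
  rw [← sub_div, ← inner_sub_right, sub_sub_sub_cancel_right, abs_div, abs_of_pos hη,
    div_lt_one hη] at h1
  exact h1

variable [MeasurableSpace E] [BorelSpace E]

theorem measurable_cell [SecondCountableTopology E] {j : ℕ} (e : Fin j → E) (p : E) (η : ℝ) :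
    Measurable (cell e p η) := by
  refine measurable_pi_lambda _ fun i => Int.measurable_floor.comp ?_
  fun_prop

variable [FiniteDimensional ℝ E]

/-- Cut `B(y,r)` into cells of side `r/(k+1)`. These have diameter less than `r`, so each lies in
`B(x,r)` for every `x` of the cell, and hence contributes at most `1`. -/
theorem lintegral_inv_measure_ball_le (ν : Measure E) (y : E) {r : ℝ} (hr : 0 < r) :
    ∫⁻ x in Metric.ball y r, (ν (Metric.ball x r))⁻¹ ∂ν ≤
      (2 * (Module.finrank ℝ E + 1) + 1 : ℕ) ^ Module.finrank ℝ E := by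
  set k := Module.finrank ℝ E with hk
  let b := stdOrthonormalBasis ℝ E
  have hη : 0 < r / (k + 1 : ℕ) := by positivity
  let P : (Fin k → ℤ) → Set E := fun c =>
    Metric.ball y r ∩ cell (fun i => b i) y (r / (k + 1 : ℕ)) ⁻¹' {c}
  have hP : ∀ c, MeasurableSet (P c) := fun c =>
    Metric.isOpen_ball.measurableSet.inter (measurable_cell _ _ _ (measurableSet_singleton c))
  have hdisj : (↑(cellRange k (k + 1)) : Set (Fin k → ℤ)).PairwiseDisjoint P := by
    intro c _ c' _ hcc
    refine Set.disjoint_left.2 fun z hz hz' => hcc ?_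
    exact hz.2.symm.trans hz'.2
  have hU : Metric.ball y r = ⋃ c ∈ cellRange k (k + 1), P c := by
    ext z
    simp only [mem_iUnion, exists_prop]
    constructor
    · intro hz
      exact ⟨_, cell_mem (Nat.succ_pos k) (fun i => b.orthonormal.1 i) hr hz, hz, rfl⟩
    · rintro ⟨c, -, hz, -⟩
      exact hz
  have hle : ∀ c, ∫⁻ x in P c, (ν (Metric.ball x r))⁻¹ ∂ν ≤ 1 := by
    intro c
    calc ∫⁻ x in P c, (ν (Metric.ball x r))⁻¹ ∂ν ≤ ∫⁻ x in P c, (ν (P c))⁻¹ ∂ν := by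
          refine setLIntegral_mono' (hP c) fun x hx => ?_
          refine ENNReal.inv_le_inv.2 (measure_mono fun z hz => ?_)
          have h1 := abs_inner_sub_lt_of_cell_eq hη (hz.2.trans hx.2.symm)
          rw [mem_ball_iff_norm, ← b.sum_repr' (z - x)]
          refine (norm_sum_le _ _).trans_lt ?_
          calc ∑ i, ‖inner ℝ (b i) (z - x) • b i‖ ≤ ∑ i : Fin k, r / (k + 1 : ℕ) := by
                refine Finset.sum_le_sum fun i _ => ?_
                rw [norm_smul, b.orthonormal.1 i, mul_one]
                exact (h1 i).le
            _ < r := by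
                simp only [Finset.sum_const, Finset.card_univ, Fintype.card_fin, nsmul_eq_mul]
                push_cast
                rw [mul_div_assoc', div_lt_iff₀ (by positivity)]
                nlinarith
      _ ≤ 1 := by
          rw [setLIntegral_const]
          exact ENNReal.inv_mul_le_one _
  rw [hU, lintegral_biUnion_finset hdisj (fun c _ => hP c)]
  refine (Finset.sum_le_sum fun c _ => hle c).trans ?_
  simp only [Finset.sum_const, nsmul_eq_mul, mul_one, card_cellRange]
  push_cast
  rfl

/-- A measure concentrated near a low-dimensional plane has large average density at small
scales. -/
theorem measure_ball_pow_three_le (ν : Measure E) {j n : ℕ} (hn : 0 < n) {e : Fin j → E}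
    (he : ∀ i, ‖e i‖ = 1) {x : E} {r ρ : ℝ} (hr : 0 < r) {S : Set E} (hS : MeasurableSet S)
    (hSx : S ⊆ Metric.ball x r) (hm : ν (Metric.ball x r) ≤ 2 * ν S)
    (hdist : ∀ y ∈ S, ∀ z ∈ S, (∀ i, |inner ℝ (e i) (y - z)| < r / n) → dist y z < ρ) :
    ν (Metric.ball x r) ^ 3 ≤ 8 * ((2 * n + 1 : ℕ) ^ j) ^ 2 *
      ∫⁻ y in Metric.ball x r, ν (Metric.ball y ρ) ^ 2 ∂ν := by
  have hη : 0 < r / n := by positivity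
  let P : (Fin j → ℤ) → Set E := fun c => S ∩ cell e x (r / n) ⁻¹' {c}
  have hP : ∀ c, MeasurableSet (P c) := fun c =>
    hS.inter (measurable_cell _ _ _ (measurableSet_singleton c))
  have hdisj : (↑(cellRange j n) : Set (Fin j → ℤ)).PairwiseDisjoint P := by
    intro c _ c' _ hcc
    refine Set.disjoint_left.2 fun z hz hz' => hcc ?_
    exact hz.2.symm.trans hz'.2
  have hU : S = ⋃ c ∈ cellRange j n, P c := by
    ext z
    simp only [mem_iUnion, exists_prop]
    constructor
    · intro hz
      exact ⟨_, cell_mem hn he hr (hSx hz), hz, rfl⟩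
    · rintro ⟨c, -, hz, -⟩
      exact hz
  -- Power mean inequality with exponent `3` over the cells; their number is raised to the power `3
  -- - 1`.
  have h1 : ν S ^ 3 ≤ ((2 * n + 1 : ℕ) ^ j) ^ 2 * ∑ c ∈ cellRange j n, ν (P c) ^ 3 := by
    have := ENNReal.rpow_sum_le_const_mul_sum_rpow (cellRange j n) (fun c => ν (P c))
      (p := 3) (by norm_num)
    rw [← measure_biUnion_finset hdisj (fun c _ => hP c), ← hU, card_cellRange] at this
    norm_num at this
    exact_mod_cast this
  have h2 : ∑ c ∈ cellRange j n, ν (P c) ^ 3 ≤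
      ∫⁻ y in Metric.ball x r, ν (Metric.ball y ρ) ^ 2 ∂ν := by
    refine le_trans ?_ (lintegral_mono_set hSx)
    rw [hU, lintegral_biUnion_finset hdisj (fun c _ => hP c)]
    refine Finset.sum_le_sum fun c _ => ?_
    calc ν (P c) ^ 3 = ∫⁻ y in P c, ν (P c) ^ 2 ∂ν := by rw [setLIntegral_const, ← pow_succ]
      _ ≤ _ := by
        refine setLIntegral_mono' (hP c) fun y hy => ?_
        gcongr
        intro z hz
        exact hdist z hz.1 y hy.1 (abs_inner_sub_lt_of_cell_eq hη (hz.2.trans hy.2.symm))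
  calc ν (Metric.ball x r) ^ 3 ≤ (2 * ν S) ^ 3 := by gcongr
    _ = 8 * ν S ^ 3 := by ring
    _ ≤ 8 * (((2 * n + 1 : ℕ) ^ j) ^ 2 *
      ∫⁻ y in Metric.ball x r, ν (Metric.ball y ρ) ^ 2 ∂ν) := by
        gcongr
        exact h1.trans (by gcongr)
    _ = _ := by ring

theorem measurable_measure_ball (ν : Measure E) [SFinite ν] :
    Measurable fun p : E × ℝ => ν (Metric.ball p.1 p.2) := by
  have : MeasurableSet {q : (E × ℝ) × E | dist q.2 q.1.1 < q.1.2} :=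
    (isOpen_lt (by fun_prop) (by fun_prop)).measurableSet
  exact measurable_measure_prodMk_left this

theorem measurable_setLIntegral_ball (ν : Measure E) [SFinite ν] {Ψ : E → ℝ → ℝ≥0∞}
    (hΨ : Measurable (Function.uncurry Ψ)) :
    Measurable fun p : E × ℝ => ∫⁻ y in Metric.ball p.1 p.2, Ψ y p.2 ∂ν := by
  have hs : MeasurableSet {q : (E × ℝ) × E | dist q.2 q.1.1 < q.1.2} :=
    (isOpen_lt (by fun_prop) (by fun_prop)).measurableSet
  have h1 : Measurable fun q : (E × ℝ) × E => Ψ q.2 q.1.2 :=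
    hΨ.comp (measurable_snd.prodMk measurable_fst.snd)
  have h2 := (h1.indicator hs).lintegral_prod_right' (ν := ν)
  convert h2 using 1
  ext p
  rw [← lintegral_indicator Metric.isOpen_ball.measurableSet]
  rfl

/-- Averaging over balls centred at the points of the measure is bounded on `L¹`. -/
theorem lintegral_average_ball_le (ν : Measure E) [SFinite ν] {a : ℝ} (ha : 0 ≤ a)
    {Ψ : E → ℝ → ℝ≥0∞} (hΨ : Measurable (Function.uncurry Ψ)) :
    ∫⁻ x, (∫⁻ r in Ioi a, (ν (Metric.ball x r))⁻¹ * ∫⁻ y in Metric.ball x r, Ψ y r ∂ν) ∂ν ≤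
      ((2 * (Module.finrank ℝ E + 1) + 1 : ℕ) ^ Module.finrank ℝ E : ℝ≥0∞) *
        ∫⁻ y, (∫⁻ r in Ioi a, Ψ y r) ∂ν := by
  have hm := (measurable_measure_ball ν).inv.mul (measurable_setLIntegral_ball ν hΨ)
  rw [lintegral_lintegral_swap hm.aemeasurable, lintegral_lintegral_swap hΨ.aemeasurable,
    ← lintegral_const_mul']
  swap
  · finiteness
  refine setLIntegral_mono' measurableSet_Ioi fun r hr => ?_
  have hr : 0 < r := ha.trans_lt hr
  have hs : MeasurableSet {q : E × E | dist q.2 q.1 < r} :=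
    (isOpen_lt (by fun_prop) (by fun_prop)).measurableSet
  have hb : Measurable fun x : E => (ν (Metric.ball x r))⁻¹ :=
    ((measurable_measure_ball ν).comp (measurable_id.prodMk measurable_const)).inv
  have hΨr : Measurable fun y : E => Ψ y r := hΨ.comp (measurable_id.prodMk measurable_const)
  have h1 : Measurable (indicator {q : E × E | dist q.2 q.1 < r}
      fun q => (ν (Metric.ball q.1 r))⁻¹ * Ψ q.2 r) :=
    ((hb.comp measurable_fst).mul (hΨr.comp measurable_snd)).indicator hs
  -- At a fixed scale this is Tonelli with a kernel supported on the symmetric set `|x - y| < r`;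
  -- the inner integral in `x` is bounded independently of `y`.
  calc ∫⁻ x, (ν (Metric.ball x r))⁻¹ * ∫⁻ y in Metric.ball x r, Ψ y r ∂ν ∂ν
      = ∫⁻ x, ∫⁻ y, indicator {q : E × E | dist q.2 q.1 < r}
          (fun q => (ν (Metric.ball q.1 r))⁻¹ * Ψ q.2 r) (x, y) ∂ν ∂ν := by
        refine lintegral_congr fun x => ?_
        rw [← lintegral_const_mul _ hΨr, ← lintegral_indicator Metric.isOpen_ball.measurableSet]
        rfl
    _ = ∫⁻ y, ∫⁻ x, indicator {q : E × E | dist q.2 q.1 < r}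
          (fun q => (ν (Metric.ball q.1 r))⁻¹ * Ψ q.2 r) (x, y) ∂ν ∂ν :=
        lintegral_lintegral_swap h1.aemeasurable
    _ = ∫⁻ y, (∫⁻ x in Metric.ball y r, (ν (Metric.ball x r))⁻¹ ∂ν) * Ψ y r ∂ν := by
        refine lintegral_congr fun y => ?_
        rw [← lintegral_mul_const _ hb, ← lintegral_indicator Metric.isOpen_ball.measurableSet]
        refine lintegral_congr fun x => ?_
        simp only [indicator, mem_ofPred_eq, Metric.mem_ball, dist_comm]
    _ ≤ ∫⁻ y, ((2 * (Module.finrank ℝ E + 1) + 1 : ℕ) ^ Module.finrank ℝ E : ℝ≥0∞) *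
          Ψ y r ∂ν := by
        refine lintegral_mono fun y => ?_
        gcongr
        exact lintegral_inv_measure_ball_le ν y hr
    _ = _ := lintegral_const_mul _ hΨr

end
end SquareFunction

/-! ### Quantitative spanning and the linearized flux. -/

namespace SquareFunction

section

variable {E : Type*} [NormedAddCommGroup E] [InnerProductSpace ℝ E]

/-- The component of `v` orthogonal to an orthonormal family. -/
noncomputable def residual {j : ℕ} (e : Fin j → E) (v : E) : E :=
  v - ∑ i, inner ℝ (e i) v • e i

theorem residual_sub {j : ℕ} (e : Fin j → E) (v w : E) :
    residual e (v - w) = residual e v - residual e w := by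
  simp only [residual, inner_sub_right, sub_smul, Finset.sum_sub_distrib]
  abel

theorem inner_residual {j : ℕ} {e : Fin j → E} (he : Orthonormal ℝ e) (v : E) (i : Fin j) :
    inner ℝ (e i) (residual e v) = 0 := by
  rw [residual, inner_sub_right, he.inner_right_fintype, sub_self]

theorem continuous_residual {j : ℕ} (e : Fin j → E) : Continuous (residual e) := by
  unfold residual
  fun_prop

theorem orthonormal_snoc_residual {j : ℕ} {e : Fin j → E} (he : Orthonormal ℝ e) {v : E}
    (hv : residual e v ≠ 0) :
    Orthonormal ℝ (Fin.snoc e (‖residual e v‖⁻¹ • residual e v) : Fin (j + 1) → E) := by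
  constructor
  · intro i
    induction i using Fin.lastCases with
    | last => simp [norm_smul, hv]
    | cast i => simpa using he.1 i
  · intro i i' hii
    induction i using Fin.lastCases with
    | last =>
      induction i' using Fin.lastCases with
      | last => exact absurd rfl hii
      | cast i' =>
        simp only [Fin.snoc_last, Fin.snoc_castSucc, real_inner_smul_left]
        rw [real_inner_comm, inner_residual he, mul_zero]
    | cast i =>
      induction i' using Fin.lastCases with
      | last =>
        simp only [Fin.snoc_last, Fin.snoc_castSucc, real_inner_smul_right]
        rw [inner_residual he, mul_zero]
      | cast i' =>
        simp only [Fin.snoc_castSucc]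
        exact he.2 fun h => hii (by rw [h])

/-- A set that is not close to any plane of dimension less than `m` contains points that span an
`m`-dimensional space in a quantitative way. -/
theorem exists_orthonormal_of_not_flat (E : Type*) [NormedAddCommGroup E] [InnerProductSpace ℝ E]
    {δ : ℝ} (hδ : 0 < δ) (m : ℕ) :
    ∃ C : ℝ, 0 ≤ C ∧ ∀ (Z : Set E) (x₀ : E) (r : ℝ), 0 < r → (∀ z ∈ Z, ‖z - x₀‖ ≤ 2 * r) →
      (∀ j < m, ∀ e : Fin j → E, Orthonormal ℝ e → ∃ z ∈ Z, δ * r ≤ ‖residual e (z - x₀)‖) →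
      ∃ e z : Fin m → E, Orthonormal ℝ e ∧ (∀ l, z l ∈ Z) ∧
        ∀ (L : E →ₗ[ℝ] E) (i : Fin m), ‖L (e i)‖ ≤ C / r * ∑ l, ‖L (z l - x₀)‖ := by
  induction m with
  | zero =>
    refine ⟨0, le_rfl, fun Z x₀ r _ _ _ => ⟨Fin.elim0, Fin.elim0, ⟨fun i => i.elim0,
      fun i => i.elim0⟩, fun i => i.elim0, fun _ i => i.elim0⟩⟩
  | succ m ih =>
    obtain ⟨C, hC, ih⟩ := ih
    -- Gram–Schmidt: removing the `m` earlier components, each with coefficient at most `2r`, costs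
    -- `2mC`. Normalizing divides by the residual, which has norm at least `δ r`.
    refine ⟨max C ((1 + 2 * m * C) / δ), hC.trans (le_max_left _ _), ?_⟩
    intro Z x₀ r hr hZ hflat
    obtain ⟨e, z, he, hz, hL⟩ := ih Z x₀ r hr hZ fun j hj => hflat j (hj.trans (Nat.lt_succ_self m))
    obtain ⟨v, hvZ, hv⟩ := hflat m (Nat.lt_succ_self m) e he
    set w := residual e (v - x₀) with hw
    have hwpos : 0 < ‖w‖ := lt_of_lt_of_le (by positivity) hv
    refine ⟨Fin.snoc e (‖w‖⁻¹ • w), Fin.snoc z v,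
      orthonormal_snoc_residual he (norm_pos_iff.1 hwpos), ?_, ?_⟩
    · intro l
      induction l using Fin.lastCases with
      | last => simpa using hvZ
      | cast l => simpa using hz l
    · intro L i
      rw [Fin.sum_univ_castSucc]
      simp only [Fin.snoc_castSucc, Fin.snoc_last]
      set S := ∑ l, ‖L (z l - x₀)‖ with hS
      have hS0 : 0 ≤ S := Finset.sum_nonneg fun _ _ => norm_nonneg _
      have hv0 : 0 ≤ ‖L (v - x₀)‖ := norm_nonneg _
      induction i using Fin.lastCases with
      | cast i =>
        simp only [Fin.snoc_castSucc]
        refine (hL L i).trans ?_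
        gcongr
        · exact le_max_left _ _
        · linarith
      | last =>
        simp only [Fin.snoc_last]
        have h1 : ‖L w‖ ≤ ‖L (v - x₀)‖ + 2 * m * C * S := by
          rw [hw, residual, map_sub, map_sum]
          refine (norm_sub_le _ _).trans ?_
          gcongr
          refine (norm_sum_le _ _).trans ?_
          calc ∑ i, ‖L (inner ℝ (e i) (v - x₀) • e i)‖ ≤ ∑ i : Fin m, (2 * r) * (C / r * S) := by
                refine Finset.sum_le_sum fun i _ => ?_
                rw [map_smul, norm_smul]
                refine mul_le_mul ?_ (hL L i) (norm_nonneg _) (by positivity)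
                refine (norm_inner_le_norm _ _).trans ?_
                rw [he.1 i, one_mul]
                exact hZ v hvZ
            _ = 2 * m * C * S := by
                simp only [Finset.sum_const, Finset.card_univ, Fintype.card_fin, nsmul_eq_mul]
                field_simp
        rw [map_smul, norm_smul, norm_inv, norm_norm]
        calc ‖w‖⁻¹ * ‖L w‖ ≤ (δ * r)⁻¹ * ((1 + 2 * m * C) * (S + ‖L (v - x₀)‖)) := by
              have h2 : 0 ≤ 2 * m * C * ‖L (v - x₀)‖ := by positivity
              gcongr
              nlinarith
          _ = (1 + 2 * m * C) / δ / r * (S + ‖L (v - x₀)‖) := by field_simp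
          _ ≤ _ := by
              gcongr
              exact le_max_right _ _

end

section

variable {E : Type*} [NormedAddCommGroup E] [InnerProductSpace ℝ E] [FiniteDimensional ℝ E]
  [MeasurableSpace E] [BorelSpace E]

namespace IsProfile

variable {g : ℝ → ℝ} (hg : IsProfile g)
include hg

theorem stronglyMeasurable_flux (ν : Measure E) [IsFiniteMeasure ν] :
    StronglyMeasurable fun p : ℝ × E => flux g ν p.1 p.2 := by
  unfold flux
  refine StronglyMeasurable.integral_prod_right (f := fun (p : ℝ × E) y =>
    field g (p.1⁻¹ • (p.2 - y))) (Measurable.stronglyMeasurable ?_)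
  exact hg.continuous_field.measurable.comp
    (measurable_fst.fst.inv.smul (measurable_fst.snd.sub measurable_snd))

theorem integrable_field (ν : Measure E) [IsFiniteMeasure ν] (t : ℝ) (x : E) :
    Integrable (fun y => field g (t⁻¹ • (x - y))) ν := by
  refine Integrable.of_bound (C := 2) ?_ (ae_of_all _ fun _ => hg.norm_field_le _)
  exact (hg.continuous_field.comp (by fun_prop)).aestronglyMeasurable

theorem integrable_fderiv_field (ν : Measure E) [IsFiniteMeasure ν] (t : ℝ) (x : E) :
    Integrable (fun y => fderiv ℝ (field g) (t⁻¹ • (x - y))) ν := by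
  have hc : Continuous (fderiv ℝ (field g : E → E)) := hg.contDiff_fderiv_field.continuous
  obtain ⟨C, hC⟩ := (hg.hasCompactSupport_field.fderiv ℝ
    (f := (field g : E → E))).exists_bound_of_continuous hc
  refine Integrable.of_bound (C := C) ?_ (ae_of_all _ fun _ => hC _)
  exact (hc.comp (by fun_prop)).aestronglyMeasurable

/-- The linearization of the flux at a point, up to a factor `t`. -/
theorem exists_linearization (E : Type*) [NormedAddCommGroup E] [InnerProductSpace ℝ E]
    [FiniteDimensional ℝ E] [MeasurableSpace E] [BorelSpace E] : ∃ C : ℝ, 0 ≤ C ∧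
      ∀ (ν : Measure E) [IsFiniteMeasure ν] (x v : E) (t : ℝ), 0 < t → ‖v‖ ≤ 2 * t →
        ‖(∫ y, fderiv ℝ (field g) (t⁻¹ • (x - y)) ∂ν) v‖ ≤
          t * (‖flux g ν t (x + v)‖ + ‖flux g ν t x‖) +
            C * (‖v‖ ^ 2 / t) * ν.real (Metric.ball x (4 * t)) := by
  obtain ⟨C, hC, hT⟩ := hg.exists_taylor (E := E)
  refine ⟨C, hC, fun ν _ x v t ht hv => ?_⟩
  set A := ∫ y, fderiv ℝ (field g) (t⁻¹ • (x - y)) ∂ν with hA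
  have hb : ∀ y, ‖field g (t⁻¹ • (x + v - y)) - field g (t⁻¹ • (x - y)) -
      fderiv ℝ (field g) (t⁻¹ • (x - y)) (t⁻¹ • v)‖ ≤
        (Metric.ball x (4 * t)).indicator (fun _ => C * (‖v‖ / t) ^ 2) y := by
    intro y
    have e1 : t⁻¹ • (x + v - y) = t⁻¹ • (x - y) + t⁻¹ • v := by
      rw [← smul_add]
      congr 1
      abel
    have hnv : ‖t⁻¹ • v‖ = ‖v‖ / t := by
      rw [norm_smul, norm_inv, Real.norm_of_nonneg ht.le, inv_mul_eq_div]
    rw [e1]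
    by_cases hy : y ∈ Metric.ball x (4 * t)
    · rw [indicator_of_mem hy, ← hnv]
      exact hT _ _
    · rw [indicator_of_notMem hy, hg.taylor_eq_zero, norm_zero]
      · rw [Metric.mem_ball', dist_eq_norm, not_lt] at hy
        rw [norm_smul, norm_inv, Real.norm_of_nonneg ht.le, inv_mul_eq_div, le_div_iff₀ ht]
        exact hy
      · rw [hnv, div_le_iff₀ ht]
        exact hv
  have hint := hg.integrable_fderiv_field ν t x
  have hint2 := hint.apply_continuousLinearMap (t⁻¹ • v)
  have h1 : flux g ν t (x + v) - flux g ν t x - A (t⁻¹ • v) =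
      ∫ y, (field g (t⁻¹ • (x + v - y)) - field g (t⁻¹ • (x - y)) -
        fderiv ℝ (field g) (t⁻¹ • (x - y)) (t⁻¹ • v)) ∂ν := by
    have hint3 : Integrable (fun y => field g (t⁻¹ • (x + v - y)) - field g (t⁻¹ • (x - y))) ν :=
      (hg.integrable_field ν t _).sub (hg.integrable_field ν t _)
    rw [integral_sub hint3 hint2,
      integral_sub (hg.integrable_field ν t _) (hg.integrable_field ν t _), hA,
      ContinuousLinearMap.integral_apply hint]
    rfl
  have h2 : ‖flux g ν t (x + v) - flux g ν t x - A (t⁻¹ • v)‖ ≤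
      C * (‖v‖ / t) ^ 2 * ν.real (Metric.ball x (4 * t)) := by
    rw [h1]
    refine (norm_integral_le_of_norm_le ?_ (ae_of_all _ hb)).trans ?_
    · exact (integrable_const _).indicator Metric.isOpen_ball.measurableSet
    · rw [integral_indicator_const _ Metric.isOpen_ball.measurableSet, smul_eq_mul, mul_comm]
  have h3 : A v = t • A (t⁻¹ • v) := by
    rw [map_smul, smul_smul, mul_inv_cancel₀ ht.ne', one_smul]
  rw [h3, norm_smul, Real.norm_of_nonneg ht.le]
  have h4 : ‖A (t⁻¹ • v)‖ ≤ ‖flux g ν t (x + v)‖ + ‖flux g ν t x‖ +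
      ‖flux g ν t (x + v) - flux g ν t x - A (t⁻¹ • v)‖ := by
    have e : A (t⁻¹ • v) = (flux g ν t (x + v) - flux g ν t x) -
      (flux g ν t (x + v) - flux g ν t x - A (t⁻¹ • v)) := by abel
    calc ‖A (t⁻¹ • v)‖ = _ := congrArg norm e
      _ ≤ _ := (norm_sub_le _ _).trans (by gcongr; exact norm_sub_le _ _)
  calc t * ‖A (t⁻¹ • v)‖ ≤ t * (‖flux g ν t (x + v)‖ + ‖flux g ν t x‖ +
      C * (‖v‖ / t) ^ 2 * ν.real (Metric.ball x (4 * t))) := by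
        gcongr
        linarith
    _ = _ := by field_simp

end IsProfile

end
end SquareFunction

/-! ### Small flux forces growth of the mass. -/

namespace SquareFunction

namespace IsProfile

variable {g : ℝ → ℝ} (hg : IsProfile g)
include hg

theorem continuous_deriv : Continuous (deriv g) :=
  hg.smooth.continuous_deriv (by simp)

theorem hasDerivAt_div_pow (K : ℕ) (c : ℝ) {t : ℝ} (ht : 0 < t) :
    HasDerivAt (fun t => g (c / t ^ 2) / t ^ K)
      (-((K * g (c / t ^ 2) + 2 * deriv g (c / t ^ 2) * (c / t ^ 2)) / t ^ (K + 1))) t := by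
  have h1 : HasDerivAt (fun t : ℝ => c / t ^ 2) (-(2 * c / t ^ 3)) t := by
    refine ((hasDerivAt_const t c).div (hasDerivAt_pow 2 t) (by positivity)).congr_deriv ?_
    simp only [zero_mul, zero_sub, Nat.cast_ofNat, Nat.add_one_sub_one, pow_one]
    field_simp
  have h2 : HasDerivAt g (deriv g (c / t ^ 2)) (c / t ^ 2) :=
    (hg.smooth.differentiable (by simp)).differentiableAt.hasDerivAt
  refine ((h2.comp t h1).div (hasDerivAt_pow K t) (by positivity)).congr_deriv ?_
  simp only [Function.comp]
  rcases K with _ | K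
  · simp only [Nat.cast_zero, zero_mul, zero_add, pow_zero, mul_zero, sub_zero]
    field_simp
  · simp only [Nat.add_sub_cancel]
    field_simp
    push_cast
    ring

theorem exists_bound_divergence (K : ℕ) :
    ∃ C : ℝ, ∀ q : ℝ, 0 ≤ q → |K * g q + 2 * deriv g q * q| ≤ C := by
  have hc : Continuous fun q => K * g q + 2 * deriv g q * q :=
    (hg.smooth.continuous.const_smul (K : ℝ)).add
      ((hg.continuous_deriv.const_smul (2 : ℝ)).mul continuous_id)
  -- Any endpoint above `4` works: `g` then vanishes in a neighbourhood of every point beyond it,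
  -- and so does its derivative.
  obtain ⟨C, hC⟩ := isCompact_Icc.exists_bound_of_continuousOn (s := Icc (0 : ℝ) 5) hc.continuousOn
  refine ⟨C, fun q hq => ?_⟩
  rcases le_or_gt q 5 with h | h
  · exact hC q ⟨hq, h⟩
  · have h0 : deriv g q = 0 := by
      have : g =ᶠ[nhds q] fun _ => 0 := by
        filter_upwards [Ioi_mem_nhds h] with x hx
        have hx : 5 < x := hx
        exact hg.eq_zero _ (by linarith)
      rw [this.deriv_eq, deriv_const]
    rw [h0, hg.eq_zero q (by linarith)]
    have := hC 0 ⟨le_rfl, by norm_num⟩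
    simp only [mul_zero, zero_mul, add_zero, abs_zero]
    exact (norm_nonneg _).trans this

variable {E : Type*} [NormedAddCommGroup E] [InnerProductSpace ℝ E] [FiniteDimensional ℝ E]
  [MeasurableSpace E] [BorelSpace E]

theorem integrable_profile {E : Type*} [NormedAddCommGroup E] [MeasurableSpace E] [BorelSpace E]
    (ν : Measure E) [IsFiniteMeasure ν] (x : E) (t : ℝ) :
    Integrable (fun y => g (‖x - y‖ ^ 2 / t ^ 2)) ν := by
  refine Integrable.of_bound (C := 1) ?_ (ae_of_all _ fun _ => ?_)
  · exact (hg.smooth.continuous.comp (by fun_prop)).aestronglyMeasurable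
  · rw [Real.norm_of_nonneg (hg.nonneg _)]
    exact hg.le_one _

theorem measureReal_ball_le_integral {E : Type*} [NormedAddCommGroup E] [MeasurableSpace E]
    [BorelSpace E] (ν : Measure E) [IsFiniteMeasure ν] (x : E) {t : ℝ}
    (ht : 0 < t) : ν.real (Metric.ball x t) ≤ ∫ y, g (‖x - y‖ ^ 2 / t ^ 2) ∂ν := by
  rw [← integral_indicator_one Metric.isOpen_ball.measurableSet]
  refine integral_mono ((integrable_const 1).indicator Metric.isOpen_ball.measurableSet)
    (hg.integrable_profile ν x t) fun y => ?_
  by_cases hy : y ∈ Metric.ball x t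
  · rw [indicator_of_mem hy, hg.eq_one]
    · rfl
    · rw [Metric.mem_ball', dist_eq_norm] at hy
      rw [div_lt_one (by positivity)]
      gcongr
  · rw [indicator_of_notMem hy]
    exact hg.nonneg _

theorem integral_le_measureReal_ball {E : Type*} [NormedAddCommGroup E] [MeasurableSpace E]
    [BorelSpace E] (ν : Measure E) [IsFiniteMeasure ν] (x : E) {t : ℝ}
    (ht : 0 < t) : ∫ y, g (‖x - y‖ ^ 2 / t ^ 2) ∂ν ≤ ν.real (Metric.ball x (2 * t)) := by
  rw [← integral_indicator_one Metric.isOpen_ball.measurableSet]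
  refine integral_mono (hg.integrable_profile ν x t)
    ((integrable_const 1).indicator Metric.isOpen_ball.measurableSet) fun y => ?_
  by_cases hy : y ∈ Metric.ball x (2 * t)
  · rw [indicator_of_mem hy]
    exact hg.le_one _
  · rw [indicator_of_notMem hy, hg.eq_zero]
    rw [Metric.mem_ball', dist_eq_norm, not_lt] at hy
    rw [le_div_iff₀ (by positivity)]
    nlinarith

/-- Integrated form of the differential inequality for the mollified mass of balls. -/
theorem integral_profile_sub_le (ν : Measure E) [IsFiniteMeasure ν] (x : E) (K : ℕ) {a b : ℝ}
    (ha : 0 < a) (hab : a ≤ b) {U : ℝ → ℝ} (hU : IntegrableOn U (Ioc a b))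
    (hDU : ∀ t ∈ Ioc a b, (∫ y, (K * g (‖x - y‖ ^ 2 / t ^ 2) +
      2 * deriv g (‖x - y‖ ^ 2 / t ^ 2) * (‖x - y‖ ^ 2 / t ^ 2)) ∂ν) / t ^ (K + 1) ≤ U t) :
    (∫ y, g (‖x - y‖ ^ 2 / a ^ 2) ∂ν) / a ^ K - (∫ y, g (‖x - y‖ ^ 2 / b ^ 2) ∂ν) / b ^ K ≤
      ∫ t in Ioc a b, U t := by
  let ψ : ℝ → E → ℝ := fun t y => (K * g (‖x - y‖ ^ 2 / t ^ 2) +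
      2 * deriv g (‖x - y‖ ^ 2 / t ^ 2) * (‖x - y‖ ^ 2 / t ^ 2)) / t ^ (K + 1)
  have hψm : Measurable (Function.uncurry ψ) := by
    have h1 : Measurable fun p : ℝ × E => ‖x - p.2‖ ^ 2 / p.1 ^ 2 := by fun_prop
    have h2 := hg.smooth.continuous.measurable.comp h1
    have h3 := hg.continuous_deriv.measurable.comp h1
    exact ((h2.const_mul _).add ((h3.const_mul 2).mul h1)).div (measurable_fst.pow_const _)
  obtain ⟨C, hC⟩ := hg.exists_bound_divergence K
  have hint : Integrable (Function.uncurry ψ) ((volume.restrict (Ioc a b)).prod ν) := by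
    refine Integrable.of_bound (C := C / a ^ (K + 1)) hψm.aestronglyMeasurable ?_
    have h1 : ∀ᵐ t ∂(volume.restrict (Ioc a b)), t ∈ Ioc a b := ae_restrict_mem measurableSet_Ioc
    have h2 : ∀ᵐ p ∂((volume.restrict (Ioc a b)).prod ν), p.1 ∈ Ioc a b :=
      Measure.quasiMeasurePreserving_fst.ae h1
    filter_upwards [h2] with p hp
    have hp0 : 0 < p.1 := ha.trans hp.1
    simp only [Function.uncurry, ψ]
    rw [norm_div, Real.norm_eq_abs, Real.norm_of_nonneg (by positivity)]
    have h3 := hC (‖x - p.2‖ ^ 2 / p.1 ^ 2) (by positivity)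
    have h4 := (abs_nonneg _).trans h3
    gcongr
    exact hp.1.le
  have hftc : ∀ y, g (‖x - y‖ ^ 2 / a ^ 2) / a ^ K - g (‖x - y‖ ^ 2 / b ^ 2) / b ^ K =
      ∫ t in Ioc a b, ψ t y := by
    intro y
    have hpos : ∀ t ∈ uIcc a b, 0 < t := fun t ht => by
      rw [uIcc_of_le hab] at ht
      exact ha.trans_le ht.1
    have h1 : ∀ t ∈ uIcc a b, HasDerivAt (fun t => g (‖x - y‖ ^ 2 / t ^ 2) / t ^ K)
        (-ψ t y) t := fun t ht => hg.hasDerivAt_div_pow K _ (hpos t ht)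
    have h2 : ContinuousOn (fun t => ψ t y) (uIcc a b) := by
      have h3 : ContinuousOn (fun t : ℝ => ‖x - y‖ ^ 2 / t ^ 2) (uIcc a b) :=
        continuousOn_const.div (by fun_prop) fun t ht => (pow_pos (hpos t ht) 2).ne'
      have h4 := hg.smooth.continuous.comp_continuousOn h3
      have h5 := hg.continuous_deriv.comp_continuousOn h3
      exact ((continuousOn_const.mul h4).add ((continuousOn_const.mul h5).mul h3)).div
        (by fun_prop) fun t ht => (pow_pos (hpos t ht) _).ne'
    have h3 := intervalIntegral.integral_eq_sub_of_hasDerivAt h1 h2.neg.intervalIntegrable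
    rw [intervalIntegral.integral_neg, intervalIntegral.integral_of_le hab] at h3
    linarith
  calc _ = ∫ y, (g (‖x - y‖ ^ 2 / a ^ 2) / a ^ K - g (‖x - y‖ ^ 2 / b ^ 2) / b ^ K) ∂ν := by
        rw [integral_sub ((hg.integrable_profile ν x a).div_const _)
          ((hg.integrable_profile ν x b).div_const _), integral_div, integral_div]
    _ = ∫ y, (∫ t in Ioc a b, ψ t y) ∂ν := by simp_rw [hftc]
    _ = ∫ t in Ioc a b, (∫ y, ψ t y ∂ν) := (integral_integral_swap hint).symm
    _ ≤ _ := by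
      refine setIntegral_mono_on hint.integral_prod_left hU measurableSet_Ioc fun t ht => ?_
      simp only [ψ]
      rw [integral_div]
      exact hDU t ht

/-- Integrate `le_sum_inner_fderiv` and pass the partial trace through the integral. The left side
is minus `t^(K+1)` times the derivative of `t^(-K) ∫ g(|x-y|²/t²) dν`, so smallness of the
linearized flux on `K` directions limits the decay of that quotient. -/
theorem integral_divergence_le (ν : Measure E) [IsFiniteMeasure ν] (x : E) {K : ℕ}
    {e : Fin K → E} (he : Orthonormal ℝ e) {t : ℝ} (ht : 0 < t) :
    ∫ y, (K * g (‖x - y‖ ^ 2 / t ^ 2) +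
      2 * deriv g (‖x - y‖ ^ 2 / t ^ 2) * (‖x - y‖ ^ 2 / t ^ 2)) ∂ν ≤
      ∑ i, ‖(∫ y, fderiv ℝ (field g) (t⁻¹ • (x - y)) ∂ν) (e i)‖ := by
  have hint := hg.integrable_fderiv_field ν t x
  have hint' : ∀ i, Integrable (fun y => inner ℝ (fderiv ℝ (field g) (t⁻¹ • (x - y)) (e i)) (e i)) ν :=
    fun i => (hint.apply_continuousLinearMap (e i)).inner_const (e i)
  obtain ⟨C, hC⟩ := hg.exists_bound_divergence K
  have hcont : Continuous fun q => K * g q + 2 * deriv g q * q :=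
    (hg.smooth.continuous.const_smul (K : ℝ)).add
      ((hg.continuous_deriv.const_smul (2 : ℝ)).mul continuous_id)
  calc _ ≤ ∫ y, ∑ i, inner ℝ (fderiv ℝ (field g) (t⁻¹ • (x - y)) (e i)) (e i) ∂ν := by
        refine integral_mono ?_ (integrable_finsetSum _ fun i _ => hint' i) fun y => ?_
        · refine Integrable.of_bound (C := C) ?_ (ae_of_all _ fun y => hC _ (by positivity))
          exact (hcont.comp (g := fun q => K * g q + 2 * deriv g q * q)
            (f := fun y => ‖x - y‖ ^ 2 / t ^ 2) (by fun_prop)).aestronglyMeasurable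
        · have h1 : ‖t⁻¹ • (x - y)‖ ^ 2 = ‖x - y‖ ^ 2 / t ^ 2 := by
            rw [norm_smul, norm_inv, Real.norm_of_nonneg ht.le, inv_mul_eq_div, div_pow]
          have := hg.le_sum_inner_fderiv he (t⁻¹ • (x - y))
          rwa [h1] at this
    _ = ∑ i, inner ℝ ((∫ y, fderiv ℝ (field g) (t⁻¹ • (x - y)) ∂ν) (e i)) (e i) := by
        rw [integral_finsetSum _ fun i _ => hint' i]
        refine Finset.sum_congr rfl fun i _ => ?_
        rw [ContinuousLinearMap.integral_apply hint, real_inner_comm, ← integral_inner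
          (hint.apply_continuousLinearMap (e i))]
        simp_rw [real_inner_comm]
    _ ≤ _ := by
        refine Finset.sum_le_sum fun i _ => (real_inner_le_norm _ _).trans ?_
        rw [he.1 i, mul_one]

/-- If the flux is small on a set which is not close to planes of dimension less than `K`, then
the mass of balls centred on the set grows at least like the `K`-th power of the radius. -/
theorem exists_ball_growth (E : Type*) [NormedAddCommGroup E] [InnerProductSpace ℝ E]
    [FiniteDimensional ℝ E] [MeasurableSpace E] [BorelSpace E] {δ : ℝ} (hδ : 0 < δ) (K : ℕ) :
    ∃ C : ℝ, 0 ≤ C ∧ ∀ (ν : Measure E) [IsFiniteMeasure ν] (Z : Set E) (x : E) (r a b κ : ℝ),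
      0 < r → r ≤ a → a ≤ b → x ∈ Z → (∀ z ∈ Z, ‖z - x‖ ≤ 2 * r) →
      (∀ j < K, ∀ e : Fin j → E, Orthonormal ℝ e → ∃ z ∈ Z, δ * r ≤ ‖residual e (z - x)‖) →
      (∀ z ∈ Z, ∫ t in Ioc a b, ‖flux g ν t z‖ ≤ κ) →
      ν.real (Metric.ball x a) ≤ (a / b) ^ K * ν.real (Metric.ball x (2 * b)) +
        C * (κ / r) + C * (r / a) * (b / a) * ν.real (Metric.ball x (4 * b)) := by
  obtain ⟨C₁, hC₁, hsel⟩ := exists_orthonormal_of_not_flat E hδ K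
  obtain ⟨C₂, hC₂, hlin⟩ := hg.exists_linearization E
  refine ⟨K * K * C₁ * (2 + 4 * C₂), by positivity, ?_⟩
  intro ν _ Z x r a b κ hr hra hab hxZ hZ hflat hκ
  have ha : 0 < a := hr.trans_le hra
  have hb : 0 < b := ha.trans_le hab
  obtain ⟨e, z, he, hz, hL⟩ := hsel Z x r hr hZ hflat
  set N := ν.real (Metric.ball x (4 * b)) with hN
  have hN0 : 0 ≤ N := measureReal_nonneg
  let S : ℝ → ℝ := fun t => ∑ l, (‖flux g ν t (z l)‖ + ‖flux g ν t x‖)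
  -- Negative powers of `t` are replaced by those of the left endpoint `a`. What remains is the
  -- flux, whose integral is bounded through `κ`, and a constant Taylor error.
  let U : ℝ → ℝ := fun t => K * C₁ / r * (S t / a ^ K + K * (4 * C₂ * r ^ 2 / a ^ (K + 2) * N))
  have hfint : ∀ w, IntegrableOn (fun t => ‖flux g ν t w‖) (Ioc a b) := by
    intro w
    refine Measure.integrableOn_of_bounded (M := 2 * ν.real univ) (by simp) ?_ ?_
    · exact ((hg.stronglyMeasurable_flux ν).comp_measurable
        (measurable_id.prodMk measurable_const)).norm.aestronglyMeasurable
    · refine ae_of_all _ fun t => ?_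
      rw [norm_norm]
      exact hg.norm_flux_le ν t w
  have hSint : IntegrableOn S (Ioc a b) :=
    integrable_finsetSum _ fun l _ => (hfint _).add (hfint _)
  have hUint : IntegrableOn U (Ioc a b) := by
    refine Integrable.const_mul ?_ _
    exact (hSint.div_const _).add (integrable_const _)
  have key := hg.integral_profile_sub_le ν x K ha hab hUint ?_
  swap
  · intro t ht
    have ht0 : 0 < t := ha.trans ht.1
    set A := ∫ y, fderiv ℝ (field g) (t⁻¹ • (x - y)) ∂ν
    have h1 : ∀ l, ‖A (z l - x)‖ ≤ t * (‖flux g ν t (z l)‖ + ‖flux g ν t x‖) +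
        4 * C₂ * r ^ 2 / t * N := by
      intro l
      have hv := hZ _ (hz l)
      have h2 := hlin ν x (z l - x) t ht0 (hv.trans (by linarith [ht.1]))
      rw [add_sub_cancel] at h2
      refine h2.trans ?_
      gcongr
      · calc C₂ * (‖z l - x‖ ^ 2 / t) ≤ C₂ * ((2 * r) ^ 2 / t) := by gcongr
          _ = _ := by ring
      · exact measureReal_mono (Metric.ball_subset_ball (by linarith [ht.2]))
    have h3 : ∑ i, ‖A (e i)‖ ≤ K * (C₁ / r * (t * S t + K * (4 * C₂ * r ^ 2 / t * N))) := by
      have h4 : ∑ l, ‖A (z l - x)‖ ≤ t * S t + K * (4 * C₂ * r ^ 2 / t * N) := by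
        refine (Finset.sum_le_sum fun l _ => h1 l).trans (le_of_eq ?_)
        rw [Finset.sum_add_distrib, ← Finset.mul_sum, Finset.sum_const, Finset.card_univ,
          Fintype.card_fin, nsmul_eq_mul]
      calc ∑ i, ‖A (e i)‖ ≤ ∑ i : Fin K, C₁ / r * (t * S t + K * (4 * C₂ * r ^ 2 / t * N)) := by
            refine Finset.sum_le_sum fun i _ => (hL A i).trans ?_
            gcongr
            exact h4
        _ = _ := by simp
    have hS0 : 0 ≤ S t := Finset.sum_nonneg fun _ _ => by positivity
    calc _ ≤ (K * (C₁ / r * (t * S t + K * (4 * C₂ * r ^ 2 / t * N)))) / t ^ (K + 1) := by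
          gcongr
          exact (hg.integral_divergence_le ν x he ht0).trans h3
      _ = K * C₁ / r * (S t / t ^ K + K * (4 * C₂ * r ^ 2 / t ^ (K + 2) * N)) := by
          field_simp
          ring
      _ ≤ U t := by
          simp only [U]
          have := ht.1.le
          gcongr
  have hSκ : ∫ t in Ioc a b, S t ≤ K * (2 * κ) := by
    simp only [S]
    have h1 : ∀ l, Integrable (fun t => ‖flux g ν t (z l)‖ + ‖flux g ν t x‖)
        (volume.restrict (Ioc a b)) := fun l => (hfint _).add (hfint _)
    rw [integral_finsetSum _ fun l _ => h1 l]
    calc _ ≤ ∑ l : Fin K, 2 * κ := by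
          refine Finset.sum_le_sum fun l _ => ?_
          rw [integral_add (hfint _) (hfint _)]
          linarith [hκ _ (hz l), hκ x hxZ]
      _ = _ := by simp
  have hU : ∫ t in Ioc a b, U t ≤ K * C₁ / r * (K * (2 * κ) / a ^ K +
      b * (K * (4 * C₂ * r ^ 2 / a ^ (K + 2) * N))) := by
    simp only [U]
    rw [integral_const_mul, integral_add (hSint.div_const _) (integrable_const _), integral_div,
      setIntegral_const]
    simp only [Real.volume_real_Ioc_of_le hab, smul_eq_mul]
    gcongr
    linarith
  have hJa := hg.measureReal_ball_le_integral ν x ha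
  have hJb := hg.integral_le_measureReal_ball ν x hb
  have hκ0 : 0 ≤ κ := (setIntegral_nonneg measurableSet_Ioc fun _ _ => norm_nonneg _).trans
    (hκ x hxZ)
  have h5 : ν.real (Metric.ball x a) / a ^ K ≤ ν.real (Metric.ball x (2 * b)) / b ^ K +
      K * C₁ / r * (K * (2 * κ) / a ^ K + b * (K * (4 * C₂ * r ^ 2 / a ^ (K + 2) * N))) := by
    have h6 : ν.real (Metric.ball x a) / a ^ K ≤ (∫ y, g (‖x - y‖ ^ 2 / a ^ 2) ∂ν) / a ^ K := by
      gcongr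
    have h7 : (∫ y, g (‖x - y‖ ^ 2 / b ^ 2) ∂ν) / b ^ K ≤
      ν.real (Metric.ball x (2 * b)) / b ^ K := by gcongr
    linarith
  rw [div_le_iff₀ (by positivity)] at h5
  refine h5.trans ?_
  have h8 : (ν.real (Metric.ball x (2 * b)) / b ^ K +
      K * C₁ / r * (K * (2 * κ) / a ^ K + b * (K * (4 * C₂ * r ^ 2 / a ^ (K + 2) * N)))) * a ^ K =
      (a / b) ^ K * ν.real (Metric.ball x (2 * b)) + K * K * C₁ * 2 * (κ / r) +
        K * K * C₁ * (4 * C₂) * (r / a) * (b / a) * N := by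
    rw [div_pow]
    field_simp
    ring
  rw [h8]
  gcongr
  · linarith
  · linarith

end IsProfile

end SquareFunction

/-! ### Lower bound for the energy on non-flat balls. -/

namespace SquareFunction

/-- Take `Q = 2^σ` with `s < σ < K`. Then `p` makes growth at rate `2^K` beat `Q`, `n₁` moves far
enough up in scale to make the Taylor error small, and `n₂` makes the window long enough for `Q` to
beat `2^s`. -/
theorem exists_scale_parameters {s : ℝ} (hs : 0 < s) {K : ℕ} (hsK : s < K) (C : ℝ) :
    ∃ (Q : ℝ) (p n₁ n₂ : ℕ), 1 ≤ Q ∧ Q ^ (4 + p) ≤ (2 ^ K) ^ p / 4 ∧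
      C * 2 ^ p * Q ^ (4 + p) ≤ 2 ^ n₁ / 4 ∧
      2 * (2 ^ s) ^ n₂ * Q ^ (4 + p + n₁) < Q ^ n₂ ∧ n₁ ≤ n₂ := by
  obtain ⟨σ, hsσ, hσK⟩ := exists_between hsK
  set Q : ℝ := 2 ^ σ with hQ
  set S : ℝ := 2 ^ s with hS
  have hQ1 : 1 ≤ Q := Real.one_le_rpow (by norm_num) (by linarith)
  have hS1 : 1 ≤ S := Real.one_le_rpow (by norm_num) hs.le
  have hQ0 : 0 < Q := by linarith
  have hQK : Q < 2 ^ K := by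
    rw [hQ, ← Real.rpow_natCast]
    exact Real.rpow_lt_rpow_of_exponent_lt (by norm_num) hσK
  have hSQ : S < Q := Real.rpow_lt_rpow_of_exponent_lt (by norm_num) hsσ
  obtain ⟨p, hp⟩ : ∃ p : ℕ, Q ^ (4 + p) ≤ (2 ^ K) ^ p / 4 := by
    obtain ⟨p, hp⟩ := exists_pow_lt_of_lt_one (show 0 < 1 / (4 * Q ^ 4) by positivity)
      (show Q / 2 ^ K < 1 by rw [div_lt_one (by positivity)]; exact hQK)
    refine ⟨p, ?_⟩
    rw [div_pow, div_lt_div_iff₀ (by positivity) (by positivity)] at hp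
    rw [pow_add]
    linarith
  obtain ⟨n₁, hn₁⟩ : ∃ n₁ : ℕ, C * 2 ^ p * Q ^ (4 + p) ≤ 2 ^ n₁ / 4 := by
    obtain ⟨n₁, hn₁⟩ := pow_unbounded_of_one_lt (C * 2 ^ p * Q ^ (4 + p) * 4)
      (show (1 : ℝ) < 2 by norm_num)
    exact ⟨n₁, by linarith⟩
  obtain ⟨n₂, hn₂⟩ : ∃ n₂ : ℕ, 2 * S ^ n₂ * Q ^ (4 + p + n₁) < Q ^ n₂ := by
    obtain ⟨n₂, hn₂⟩ := exists_pow_lt_of_lt_one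
      (show 0 < 1 / (2 * Q ^ (4 + p + n₁)) by positivity)
      (show S / Q < 1 by rw [div_lt_one (by positivity)]; exact hSQ)
    refine ⟨n₂, ?_⟩
    rw [div_pow, div_lt_div_iff₀ (by positivity) (by positivity)] at hn₂
    linarith
  refine ⟨Q, p, n₁, n₂, hQ1, hp, hn₁, hn₂, ?_⟩
  by_contra! hlt
  have h1 : Q ^ n₂ ≤ Q ^ (4 + p + n₁) := pow_le_pow_right₀ hQ1 (by omega)
  have h2 : 1 ≤ S ^ n₂ := one_le_pow₀ hS1
  have h3 : 0 < Q ^ (4 + p + n₁) := by positivity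
  nlinarith

/-- Take `n₀` maximizing `F n / Q^n` on the window. It cannot lie within `4 + p` of the right end,
because there `F` is at most `2 S^n₂ F 0`, too small against `Q^n₂`. -/
theorem exists_doubling_scale {F : ℕ → ℝ} {Q S : ℝ} {p n₁ n₂ : ℕ} (hQ1 : 1 ≤ Q)
    (hn₂ : 2 * S ^ n₂ * Q ^ (4 + p + n₁) < Q ^ n₂) (hn₁₂ : n₁ ≤ n₂) (hF : Monotone F)
    (hF0 : 0 < F 0) (hF₂ : F n₂ ≤ 2 * S ^ n₂ * F 0) :
    ∃ n₀, n₁ ≤ n₀ ∧ n₀ + 4 + p ≤ n₂ ∧ F (n₀ + 4 + p) ≤ Q ^ (4 + p) * F n₀ := by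
  have hQ0 : 0 < Q := by linarith
  obtain ⟨n₀, hn₀, hmax⟩ := (Finset.Icc n₁ n₂).exists_max_image (fun n => F n / Q ^ n)
    ⟨n₁, Finset.mem_Icc.2 ⟨le_rfl, hn₁₂⟩⟩
  rw [Finset.mem_Icc] at hn₀
  have hn₀₂ : n₀ + 4 + p ≤ n₂ := by
    by_contra! hlt
    have h1 := hmax n₁ (Finset.mem_Icc.2 ⟨le_rfl, hn₁₂⟩)
    have h2 : F n₀ ≤ 2 * S ^ n₂ * F 0 := (hF hn₀.2).trans hF₂
    have h3 : F 0 ≤ F n₁ := hF (Nat.zero_le _)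
    rw [div_le_div_iff₀ (by positivity) (by positivity)] at h1
    have h5 : F 0 * Q ^ n₂ ≤ F 0 * (2 * S ^ n₂ * Q ^ (4 + p + n₁)) :=
      calc F 0 * Q ^ n₂ ≤ F 0 * Q ^ (n₀ + (4 + p)) := by
            gcongr
            omega
        _ = (F 0 * Q ^ n₀) * Q ^ (4 + p) := by ring
        _ ≤ (F n₁ * Q ^ n₀) * Q ^ (4 + p) := by gcongr
        _ ≤ (F n₀ * Q ^ n₁) * Q ^ (4 + p) := by gcongr
        _ ≤ (2 * S ^ n₂ * F 0 * Q ^ n₁) * Q ^ (4 + p) := by gcongr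
        _ = _ := by ring
    exact absurd (le_of_mul_le_mul_left h5 hF0) (not_le.2 hn₂)
  refine ⟨n₀, hn₀.1, hn₀₂, ?_⟩
  have h1 := hmax (n₀ + 4 + p) (Finset.mem_Icc.2 ⟨by omega, hn₀₂⟩)
  rw [div_le_div_iff₀ (by positivity) (by positivity)] at h1
  have h2 : Q ^ n₀ * F (n₀ + 4 + p) ≤ Q ^ n₀ * (Q ^ (4 + p) * F n₀) := by
    calc _ = F (n₀ + 4 + p) * Q ^ n₀ := by ring
      _ ≤ F n₀ * Q ^ (n₀ + 4 + p) := h1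
      _ = _ := by ring
  exact le_of_mul_le_mul_left h2 (by positivity)

namespace IsProfile

variable {g : ℝ → ℝ} (hg : IsProfile g)
include hg

variable {E : Type*} [NormedAddCommGroup E] [InnerProductSpace ℝ E] [FiniteDimensional ℝ E]
  [MeasurableSpace E] [BorelSpace E]

theorem integrableOn_norm_flux_pow (ν : Measure E) [IsFiniteMeasure ν] (z : E) (a b : ℝ) (n : ℕ) :
    IntegrableOn (fun t => ‖flux g ν t z‖ ^ n) (Ioc a b) := by
  refine Measure.integrableOn_of_bounded (M := (2 * ν.real univ) ^ n) (by simp) ?_ ?_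
  · exact (((hg.stronglyMeasurable_flux ν).comp_measurable
      (measurable_id.prodMk measurable_const)).norm.pow n).aestronglyMeasurable
  · refine ae_of_all _ fun t => ?_
    rw [norm_pow, norm_norm]
    gcongr
    exact hg.norm_flux_le ν t z

theorem measurable_energy_density (ν : Measure E) [IsFiniteMeasure ν] (s : ℝ) :
    Measurable fun q : E × ℝ => ‖flux g ν q.2 q.1‖ₑ ^ 2 * ENNReal.ofReal (q.2 ^ (-2 * s - 1)) := by
  have h1 : Measurable fun q : E × ℝ => flux g ν q.2 q.1 :=
    (hg.stronglyMeasurable_flux ν).measurable.comp (measurable_snd.prodMk measurable_fst)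
  exact (h1.enorm.pow_const 2).mul
    (ENNReal.measurable_ofReal.comp (measurable_snd.pow_const _))

/-- Cauchy–Schwarz on an interval of length at most `R`, carried out as a weighted
arithmetic–geometric mean inequality; the weight `t^(-2s-1)` is smallest at `t = R`. -/
theorem integral_norm_flux_le (ν : Measure E) [IsFiniteMeasure ν] (z : E) {s r R κ : ℝ}
    (hs : 0 < s) (hr : 0 < r) (hrR : r ≤ R) (hκ : 0 < κ)
    (h : ∫⁻ t in Ioc r R, ‖flux g ν t z‖ₑ ^ 2 * ENNReal.ofReal (t ^ (-2 * s - 1)) ≤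
      ENNReal.ofReal (κ ^ 2 / R ^ (2 * s + 2))) :
    ∫ t in Ioc r R, ‖flux g ν t z‖ ≤ κ := by
  have hR : 0 < R := hr.trans_le hrR
  have hi1 := hg.integrableOn_norm_flux_pow ν z r R 1
  have hi2 := hg.integrableOn_norm_flux_pow ν z r R 2
  simp only [pow_one] at hi1
  have h1 : ∫ t in Ioc r R, ‖flux g ν t z‖ ^ 2 ≤ κ ^ 2 / R := by
    have h2 : ENNReal.ofReal (R ^ (-2 * s - 1) * ∫ t in Ioc r R, ‖flux g ν t z‖ ^ 2) ≤
        ENNReal.ofReal (κ ^ 2 / R ^ (2 * s + 2)) := by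
      refine le_trans ?_ h
      rw [← integral_const_mul, ofReal_integral_eq_lintegral_ofReal (hi2.const_mul _)
        (ae_of_all _ fun t => by positivity)]
      refine setLIntegral_mono' measurableSet_Ioc fun t ht => ?_
      have ht0 : 0 < t := hr.trans ht.1
      rw [← ofReal_norm, ← ENNReal.ofReal_pow (norm_nonneg _),
        ← ENNReal.ofReal_mul (by positivity), mul_comm]
      refine ENNReal.ofReal_le_ofReal ?_
      gcongr ?_ * ?_
      exact Real.rpow_le_rpow_of_nonpos ht0 ht.2 (by linarith)
    rw [ENNReal.ofReal_le_ofReal_iff (by positivity)] at h2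
    have h3 : R ^ (-2 * s - 1) * (κ ^ 2 / R) = κ ^ 2 / R ^ (2 * s + 2) := by
      rw [show (-2 * s - 1 : ℝ) = -(2 * s + 1) by ring, Real.rpow_neg hR.le,
        show (2 * s + 2 : ℝ) = (2 * s + 1) + 1 by ring, Real.rpow_add_one hR.ne' (2 * s + 1)]
      have := Real.rpow_pos_of_pos hR (2 * s + 1)
      generalize R ^ (2 * s + 1) = X at *
      field_simp
    rw [← h3] at h2
    exact le_of_mul_le_mul_left h2 (by positivity)
  have h4 : ∀ t, ‖flux g ν t z‖ ≤ κ / (2 * R) + R / (2 * κ) * ‖flux g ν t z‖ ^ 2 := by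
    intro t
    have h5 : κ / (2 * R) + R / (2 * κ) * ‖flux g ν t z‖ ^ 2 - ‖flux g ν t z‖ =
        (κ - R * ‖flux g ν t z‖) ^ 2 / (2 * R * κ) := by
      field_simp
      ring
    have h6 : 0 ≤ (κ - R * ‖flux g ν t z‖) ^ 2 / (2 * R * κ) := by positivity
    linarith
  have h7 : IntegrableOn (fun t => κ / (2 * R) + R / (2 * κ) * ‖flux g ν t z‖ ^ 2) (Ioc r R) :=
    (integrable_const _).add (hi2.const_mul _)
  calc ∫ t in Ioc r R, ‖flux g ν t z‖
      ≤ ∫ t in Ioc r R, (κ / (2 * R) + R / (2 * κ) * ‖flux g ν t z‖ ^ 2) :=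
        setIntegral_mono hi1 h7 h4
    _ = (R - r) * (κ / (2 * R)) + R / (2 * κ) * ∫ t in Ioc r R, ‖flux g ν t z‖ ^ 2 := by
        rw [integral_add (integrable_const _) (hi2.const_mul _), integral_const_mul,
          setIntegral_const, Real.volume_real_Ioc_of_le hrR, smul_eq_mul]
    _ ≤ R * (κ / (2 * R)) + R / (2 * κ) * (κ ^ 2 / R) := by
        gcongr
        linarith
    _ = κ := by
        field_simp
        ring

/-- If a measure is neither concentrated near planes of dimension less than `K` nor growing fast
at larger scales, then its square function is large. -/
theorem exists_energy_lower_bound (E : Type*) [NormedAddCommGroup E] [InnerProductSpace ℝ E]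
    [FiniteDimensional ℝ E] [MeasurableSpace E] [BorelSpace E] {s : ℝ} (hs : 0 < s) {K : ℕ}
    (hsK : s < K) {δ : ℝ} (hδ : 0 < δ) :
    ∃ T c : ℝ, 1 ≤ T ∧ 0 < c ∧ ∀ (ν : Measure E) [IsFiniteMeasure ν] (x : E) (r : ℝ), 0 < r →
      (∀ j < K, ∀ e : Fin j → E, Orthonormal ℝ e → ∀ p : E,
        2 * ν.real (Metric.ball x r ∩ {y | ‖residual e (y - p)‖ < δ * r}) <
          ν.real (Metric.ball x r)) →
      ν.real (Metric.ball x (T * r)) ≤ 2 * T ^ s * ν.real (Metric.ball x r) →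
      ENNReal.ofReal (c * ν.real (Metric.ball x r) ^ 2 / r ^ (2 * s)) * ν (Metric.ball x r) ≤
        ∫⁻ y in Metric.ball x r, (∫⁻ t in Ioc r (T * r),
          ‖flux g ν t y‖ₑ ^ 2 * ENNReal.ofReal (t ^ (-2 * s - 1))) ∂ν := by
  obtain ⟨C, hC, hgrow⟩ := hg.exists_ball_growth E hδ K
  obtain ⟨Q, p, n₁, n₂, hQ1, hp, hn₁, hn₂, hn₁₂⟩ := exists_scale_parameters hs hsK C
  set S : ℝ := 2 ^ s with hS
  have hQ0 : 0 < Q := by linarith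
  set T : ℝ := 2 ^ n₂ with hT
  have hT1 : 1 ≤ T := one_le_pow₀ (by norm_num)
  have hTS : T ^ s = S ^ n₂ := by
    rw [hT, hS, ← Real.rpow_natCast, ← Real.rpow_natCast, ← Real.rpow_mul (by norm_num),
      ← Real.rpow_mul (by norm_num), mul_comm]
  set η : ℝ := 1 / (4 * (C + 1)) with hη
  have hη0 : 0 < η := by positivity
  refine ⟨T, η ^ 2 / (2 * T ^ (2 * s + 2)), hT1, by positivity, ?_⟩
  intro ν _ x r hr hnf hng
  set m := ν.real (Metric.ball x r) with hm
  have hK : 0 < K := by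
    have : (0 : ℝ) < K := hs.trans hsK
    exact_mod_cast this
  -- The strict inequality of the non-flatness hypothesis for planes of dimension `0` already forces
  -- positive mass.
  have hm0 : 0 < m := by
    refine lt_of_le_of_lt ?_ (hnf 0 hK Fin.elim0 ⟨fun i => i.elim0, fun i => i.elim0⟩ x)
    positivity
  by_contra! hcon
  set κ := η * m * r with hκ
  have hκ0 : 0 < κ := by positivity
  -- The threshold below which `integral_norm_flux_le` gives total flux at most `κ`. The assumed
  -- energy bound is `τ/2` times the mass, so by Chebyshev the points above the threshold carry at
  -- most half of it.
  set τ := κ ^ 2 / (T * r) ^ (2 * s + 2) with hτ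
  have hτ0 : 0 < τ := by positivity
  have hτ2 : η ^ 2 / (2 * T ^ (2 * s + 2)) * m ^ 2 / r ^ (2 * s) = τ / 2 := by
    rw [hτ, hκ, Real.mul_rpow (by positivity) hr.le, Real.rpow_add hr (2 * s) 2, Real.rpow_two]
    field_simp
  rw [hτ2] at hcon
  let Ψ : E → ℝ≥0∞ := fun y => ∫⁻ t in Ioc r (T * r),
    ‖flux g ν t y‖ₑ ^ 2 * ENNReal.ofReal (t ^ (-2 * s - 1))
  have hΨm : Measurable Ψ :=
    (hg.measurable_energy_density ν s).lintegral_prod_right'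
  let Z : Set E := {y ∈ Metric.ball x r | Ψ y < ENNReal.ofReal τ}
  have hbad : ν.real (Metric.ball x r ∩ {y | ENNReal.ofReal τ ≤ Ψ y}) ≤ m / 2 := by
    have h1 := mul_meas_ge_le_lintegral (μ := ν.restrict (Metric.ball x r)) hΨm (ENNReal.ofReal τ)
    have h2 := h1.trans hcon.le
    rw [Measure.restrict_apply (measurableSet_le measurable_const hΨm), inter_comm] at h2
    have h3 := ENNReal.toReal_mono (by finiteness) h2
    rw [ENNReal.toReal_mul, ENNReal.toReal_mul, ENNReal.toReal_ofReal hτ0.le,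
      ENNReal.toReal_ofReal (by positivity)] at h3
    change τ * ν.real _ ≤ τ / 2 * m at h3
    refine le_of_mul_le_mul_left ?_ hτ0
    linarith
  have hZflat : ∀ q : E, ∀ j < K, ∀ e : Fin j → E, Orthonormal ℝ e →
      ∃ z ∈ Z, δ * r ≤ ‖residual e (z - q)‖ := by
    intro q j hj e he
    by_contra! hno
    have h1 : Metric.ball x r ⊆ (Metric.ball x r ∩ {y | ‖residual e (y - q)‖ < δ * r}) ∪
        (Metric.ball x r ∩ {y | ENNReal.ofReal τ ≤ Ψ y}) := by
      intro y hy
      by_cases hy' : Ψ y < ENNReal.ofReal τ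
      · exact Or.inl ⟨hy, hno y ⟨hy, hy'⟩⟩
      · exact Or.inr ⟨hy, not_lt.1 hy'⟩
    have h2 := (measureReal_mono (μ := ν) h1).trans (measureReal_union_le _ _)
    have h3 := hnf j hj e he q
    linarith
  obtain ⟨x₀, hx₀, -⟩ := hZflat x 0 hK Fin.elim0 ⟨fun i => i.elim0, fun i => i.elim0⟩
  have hZ2 : ∀ z ∈ Z, ‖z - x₀‖ ≤ 2 * r := by
    intro z hz
    have h1 := Metric.mem_ball.1 hz.1
    have h2 := Metric.mem_ball.1 hx₀.1
    rw [← dist_eq_norm]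
    linarith [dist_triangle_right z x₀ x]
  have hTr : r ≤ T * r := le_mul_of_one_le_left hr.le hT1
  have hZκ : ∀ z ∈ Z, ∫ t in Ioc r (T * r), ‖flux g ν t z‖ ≤ κ := fun z hz =>
    hg.integral_norm_flux_le ν z hs hr hTr hκ0 hz.2.le
  let F : ℕ → ℝ := fun n => ν.real (Metric.ball x (2 ^ n * r))
  have hFmono : ∀ {n n' : ℕ}, n ≤ n' → F n ≤ F n' := fun {n n'} h =>
    measureReal_mono (Metric.ball_subset_ball (by gcongr; norm_num))
  have hF0 : F 0 = m := by simp [F, hm]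
  obtain ⟨n₀, hn₁₀, hn₀₂, hN⟩ := exists_doubling_scale hQ1 hn₂ hn₁₂ (F := F)
    (fun _ _ h => hFmono h) (hF0 ▸ hm0) (by rw [hF0, ← hTS]; exact hng)
  have hmF : m ≤ F n₀ := hF0 ▸ hFmono (Nat.zero_le _)
  -- One dyadic step lets `B(x₀,a)` contain `B(x, 2^n₀ r)` despite the change of centre; likewise
  -- `B(x₀,4b)` lies in `B(x,8b)`. This explains the `4` in `4 + p`. Each of the three error terms
  -- below is at most `F n₀ / 4`.
  set a : ℝ := 2 ^ (n₀ + 1) * r with ha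
  set b : ℝ := 2 ^ p * a with hb
  have h2n : r ≤ 2 ^ n₀ * r := le_mul_of_one_le_left hr.le (one_le_pow₀ (by norm_num))
  have hra : r ≤ a := le_mul_of_one_le_left hr.le (one_le_pow₀ (by norm_num))
  have ha0 : 0 < a := hr.trans_le hra
  have hab : a ≤ b := le_mul_of_one_le_left ha0.le (one_le_pow₀ (by norm_num))
  have hb0 : 0 < b := ha0.trans_le hab
  have h8b : 8 * b = 2 ^ (n₀ + 4 + p) * r := by
    rw [hb, ha]
    ring
  have hbT : b ≤ T * r := by
    have h1 : (2 : ℝ) ^ (n₀ + 4 + p) * r ≤ 2 ^ n₂ * r := by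
      gcongr
      norm_num
    linarith
  have key := hgrow ν Z x₀ r a b κ hr hra hab hx₀ hZ2 (hZflat x₀) fun z hz => by
    refine (setIntegral_mono_set ?_ (ae_of_all _ fun _ => norm_nonneg _)
      (Ioc_subset_Ioc hra hbT).eventuallyLE).trans (hZκ z hz)
    simpa using hg.integrableOn_norm_flux_pow ν z r (T * r) 1
  have hx₀r := Metric.mem_ball.1 hx₀.1
  have h1 : F n₀ ≤ ν.real (Metric.ball x₀ a) := by
    refine measureReal_mono (Metric.ball_subset_ball' ?_)
    rw [dist_comm] at hx₀r
    have h2 : a = 2 ^ n₀ * r + 2 ^ n₀ * r := by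
      rw [ha]
      ring
    linarith
  have h4b : ν.real (Metric.ball x₀ (4 * b)) ≤ Q ^ (4 + p) * F n₀ := by
    refine le_trans (measureReal_mono (Metric.ball_subset_ball' ?_)) hN
    rw [← h8b]
    linarith
  have h2b : ν.real (Metric.ball x₀ (2 * b)) ≤ Q ^ (4 + p) * F n₀ :=
    (measureReal_mono (Metric.ball_subset_ball (by linarith))).trans h4b
  have hF : 0 < F n₀ := hm0.trans_le hmF
  have t1 : (a / b) ^ K * ν.real (Metric.ball x₀ (2 * b)) ≤ F n₀ / 4 := by
    have e1 : (a / b) ^ K = ((2 ^ K) ^ p)⁻¹ := by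
      rw [hb, ← pow_mul, mul_comm K p, pow_mul, ← inv_pow]
      congr 1
      field_simp
    rw [e1]
    calc _ ≤ ((2 ^ K) ^ p)⁻¹ * ((2 ^ K) ^ p / 4 * F n₀) := by
          gcongr
          exact h2b.trans (by gcongr)
      _ = F n₀ / 4 := by field_simp
  have t2 : C * (κ / r) ≤ F n₀ / 4 := by
    have e1 : C * (κ / r) = C / (C + 1) * (m / 4) := by
      rw [hκ, hη]
      field_simp
    rw [e1]
    have : C / (C + 1) ≤ 1 := by
      rw [div_le_one (by linarith)]
      linarith
    calc _ ≤ 1 * (m / 4) := by gcongr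
      _ ≤ _ := by linarith
  have t3 : C * (r / a) * (b / a) * ν.real (Metric.ball x₀ (4 * b)) ≤ F n₀ / 4 := by
    have e1 : C * (r / a) * (b / a) = C * 2 ^ p / 2 ^ (n₀ + 1) := by
      rw [hb, ha]
      field_simp
    rw [e1]
    calc _ ≤ C * 2 ^ p / 2 ^ (n₀ + 1) * (Q ^ (4 + p) * F n₀) := by gcongr
      _ = (C * 2 ^ p * Q ^ (4 + p)) * (F n₀ / 2 ^ (n₀ + 1)) := by ring
      _ ≤ 2 ^ n₁ / 4 * (F n₀ / 2 ^ n₁) := by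
          gcongr
          · norm_num
          · omega
      _ = _ := by field_simp
  linarith

end IsProfile

end SquareFunction

/-! ### The pointwise inequality for densities. -/

namespace SquareFunction

/-- The `s`-dimensional density of a measure on a ball. -/
noncomputable def density {E : Type*} [NormedAddCommGroup E] [MeasurableSpace E] (s : ℝ)
    (ν : Measure E) (x : E) (r : ℝ) : ℝ≥0∞ :=
  ν (Metric.ball x r) / ENNReal.ofReal (r ^ s)

variable {E : Type*} [NormedAddCommGroup E] [InnerProductSpace ℝ E] [FiniteDimensional ℝ E]
  [MeasurableSpace E] [BorelSpace E]

theorem measurable_density (s : ℝ) (ν : Measure E) [SFinite ν] :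
    Measurable fun p : E × ℝ => density s ν p.1 p.2 :=
  (measurable_measure_ball ν).div (ENNReal.measurable_ofReal.comp (measurable_snd.pow_const _))

theorem density_sq {E : Type*} [NormedAddCommGroup E] [MeasurableSpace E] {s : ℝ}
    (ν : Measure E) (x : E) {r : ℝ} (hr : 0 < r) :
    density s ν x r ^ 2 = ν (Metric.ball x r) ^ 2 * ENNReal.ofReal (r ^ (-2 * s)) := by
  rw [density, div_eq_mul_inv, mul_pow, ← ENNReal.ofReal_inv_of_pos (by positivity),
    ← ENNReal.ofReal_pow (by positivity), ← Real.rpow_neg hr.le, ← Real.rpow_natCast (r ^ (-s)),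
    ← Real.rpow_mul hr.le]
  congr 3
  push_cast
  ring

/-- The left side is of order `n^(2(K-1) - 2s)`, which tends to `0`; this is where planes of
dimension below `s` become negligible. -/
theorem exists_fine_grid {s : ℝ} (hs : 0 < s) {K : ℕ} (hsK : (K : ℝ) - 1 < s) {D : ℝ} (hD : 0 < D) :
    ∃ n : ℕ, K + 1 ≤ n ∧
      8 * ((2 * n + 1 : ℝ) ^ (K - 1)) ^ 2 * ((K + 1 : ℝ) / n) ^ (2 * s) ≤ D := by
  have hlim : Filter.Tendsto (fun n : ℕ => (8 * (3 ^ (K - 1)) ^ 2 * (K + 1 : ℝ) ^ (2 * s)) *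
      (n : ℝ) ^ (-(2 * s - 2 * ((K - 1 : ℕ) : ℝ)))) Filter.atTop (nhds 0) := by
    have hpos : 0 < 2 * s - 2 * ((K - 1 : ℕ) : ℝ) := by
      rcases K with _ | K
      · simpa using hs
      · push_cast [Nat.add_sub_cancel] at hsK ⊢
        linarith
    simpa using ((tendsto_rpow_neg_atTop hpos).comp tendsto_natCast_atTop_atTop).const_mul
      (8 * (3 ^ (K - 1)) ^ 2 * (K + 1 : ℝ) ^ (2 * s))
  obtain ⟨n, hn1, hn2⟩ := ((hlim.eventually (gt_mem_nhds hD)).and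
    (Filter.eventually_ge_atTop (K + 1))).exists
  refine ⟨n, hn2, le_trans ?_ hn1.le⟩
  have hn : (1 : ℝ) ≤ n := by
    have : 1 ≤ n := by omega
    exact_mod_cast this
  have hn0 : (0 : ℝ) < n := by linarith
  have e1 : (n : ℝ) ^ (-(2 * s - 2 * ((K - 1 : ℕ) : ℝ))) =
      (n ^ (K - 1)) ^ 2 * ((n : ℝ) ^ (2 * s))⁻¹ := by
    rw [← Real.rpow_neg hn0.le, ← pow_mul, ← Real.rpow_natCast, ← Real.rpow_add hn0]
    congr 1
    push_cast
    ring
  rw [e1, Real.div_rpow (by positivity) hn0.le]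
  calc _ ≤ 8 * ((3 * n : ℝ) ^ (K - 1)) ^ 2 * ((K + 1 : ℝ) ^ (2 * s) / (n : ℝ) ^ (2 * s)) := by
        gcongr
        linarith
    _ = _ := by
        rw [mul_pow]
        field_simp

/-- Two points of a common cell differ by at most `j r/n` along the plane and by less than `2r/n`
across it, hence by less than `(K+1) r/n`. Then `measure_ball_pow_three_le` applies, divided by the
mass of the ball. -/
theorem density_sq_le_of_flat {s : ℝ} (ν : Measure E) [IsFiniteMeasure ν] {x : E}
    {r : ℝ} (hr : 0 < r) {K n j : ℕ} (hn : 0 < n) (hj : j < K) {e : Fin j → E}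
    (he : Orthonormal ℝ e) (p : E)
    (h : ν.real (Metric.ball x r) ≤
      2 * ν.real (Metric.ball x r ∩ {y | ‖residual e (y - p)‖ < 1 / n * r})) :
    density s ν x r ^ 2 ≤
      ENNReal.ofReal (8 * ((2 * n + 1 : ℝ) ^ (K - 1)) ^ 2 * ((K + 1 : ℝ) / n) ^ (2 * s)) *
        ((ν (Metric.ball x r))⁻¹ *
          ∫⁻ y in Metric.ball x r, density s ν y ((K + 1 : ℝ) / n * r) ^ 2 ∂ν) := by
  have hn' : (0 : ℝ) < n := by exact_mod_cast hn
  set lam : ℝ := (K + 1 : ℝ) / n with hlam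
  have hlam0 : 0 < lam := by positivity
  have hmeas : MeasurableSet (Metric.ball x r ∩ {y | ‖residual e (y - p)‖ < 1 / n * r}) := by
    refine (Metric.isOpen_ball.inter (isOpen_lt ?_ continuous_const)).measurableSet
    exact ((continuous_residual e).comp (by fun_prop)).norm
  have h' : ν (Metric.ball x r) ≤
      2 * ν (Metric.ball x r ∩ {y | ‖residual e (y - p)‖ < 1 / n * r}) := by
    rw [← ofReal_measureReal, ← ofReal_measureReal (μ := ν), ← ENNReal.ofReal_ofNat,
      ← ENNReal.ofReal_mul (by norm_num)]
    exact ENNReal.ofReal_le_ofReal h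
  have key := measure_ball_pow_three_le ν hn (ρ := lam * r) he.1 hr hmeas inter_subset_left h' ?_
  swap
  · intro y hy z hz hyz
    have h1 : y - z = residual e (y - p) - residual e (z - p) +
        ∑ i, inner ℝ (e i) (y - z) • e i := by
      rw [← residual_sub, sub_sub_sub_cancel_right, residual]
      abel
    have h2 : ‖∑ i, inner ℝ (e i) (y - z) • e i‖ ≤ j * (r / n) := by
      refine (norm_sum_le _ _).trans ?_
      calc _ ≤ ∑ i : Fin j, r / n := by
            refine Finset.sum_le_sum fun i _ => ?_
            rw [norm_smul, he.1 i, mul_one]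
            exact (hyz i).le
        _ = _ := by simp
    have h3 : ‖residual e (y - p)‖ < 1 / n * r := hy.2
    have h4 : ‖residual e (z - p)‖ < 1 / n * r := hz.2
    have h5 : (j : ℝ) + 1 ≤ K := by exact_mod_cast hj
    have h6 : lam * r = (K + 1) * (r / n) := by
      rw [hlam]
      ring
    have h7 : 1 / n * r = r / n := by ring
    have h8 : 0 < r / n := by positivity
    rw [dist_eq_norm]
    calc ‖y - z‖ ≤ ‖residual e (y - p)‖ + ‖residual e (z - p)‖ + j * (r / n) := by
          refine (congrArg norm h1).le.trans ?_
          exact (norm_add_le _ _).trans (add_le_add (norm_sub_le _ _) h2)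
      _ < (j + 2) * (r / n) := by
          rw [h7] at h3 h4
          linarith
      _ ≤ _ := by
          rw [h6]
          exact mul_le_mul_of_nonneg_right (by linarith) h8.le
  rcases eq_or_ne (ν (Metric.ball x r)) 0 with h0 | h0
  · rw [density, h0]
    simp
  have hfin : ν (Metric.ball x r) ≠ ⊤ := measure_ne_top _ _
  have hd : ∀ y, density s ν y (lam * r) ^ 2 =
      ν (Metric.ball y (lam * r)) ^ 2 * ENNReal.ofReal ((lam * r) ^ (-2 * s)) :=
    fun y => density_sq ν y (by positivity)
  simp_rw [hd]
  rw [lintegral_mul_const' _ _ ENNReal.ofReal_ne_top, density_sq ν x hr]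
  set m := ν (Metric.ball x r)
  set I := ∫⁻ y in Metric.ball x r, ν (Metric.ball y (lam * r)) ^ 2 ∂ν
  have e1 : m ^ 2 = m⁻¹ * m ^ 3 := by
    rw [pow_succ' m 2, ← mul_assoc, ENNReal.inv_mul_cancel h0 hfin, one_mul]
  have e2 : ENNReal.ofReal (lam ^ (2 * s)) * ENNReal.ofReal ((lam * r) ^ (-2 * s)) =
      ENNReal.ofReal (r ^ (-2 * s)) := by
    rw [← ENNReal.ofReal_mul (by positivity), Real.mul_rpow hlam0.le hr.le, ← mul_assoc,
      ← Real.rpow_add hlam0]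
    simp
  have e3 : (8 * (((2 * n + 1 : ℕ) : ℝ≥0∞) ^ j) ^ 2) ≤
      ENNReal.ofReal (8 * ((2 * n + 1 : ℝ) ^ (K - 1)) ^ 2) := by
    rw [ENNReal.ofReal_mul (by norm_num), ENNReal.ofReal_pow (by positivity),
      ENNReal.ofReal_pow (by positivity), ENNReal.ofReal_ofNat]
    have : ENNReal.ofReal (2 * n + 1) = ((2 * n + 1 : ℕ) : ℝ≥0∞) := by
      rw [← ENNReal.ofReal_natCast]
      push_cast
      rfl
    rw [this]
    gcongr
    · exact_mod_cast Nat.le_add_left 1 (2 * n)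
    · omega
  rw [ENNReal.ofReal_mul (by positivity), e1, ← e2]
  calc m⁻¹ * m ^ 3 * (ENNReal.ofReal (lam ^ (2 * s)) * ENNReal.ofReal ((lam * r) ^ (-2 * s)))
      ≤ m⁻¹ * (ENNReal.ofReal (8 * ((2 * n + 1 : ℝ) ^ (K - 1)) ^ 2) * I) *
        (ENNReal.ofReal (lam ^ (2 * s)) * ENNReal.ofReal ((lam * r) ^ (-2 * s))) := by
        gcongr
        exact key.trans (by gcongr)
    _ = _ := by ring

/-- At every point and scale, the density is controlled by the density at a larger scale, by
the average density at a smaller scale, or by the square function. -/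
theorem IsProfile.exists_density_sq_le {g : ℝ → ℝ} (hg : IsProfile g) (E : Type*)
    [NormedAddCommGroup E] [InnerProductSpace ℝ E] [FiniteDimensional ℝ E] [MeasurableSpace E]
    [BorelSpace E] {s : ℝ} (hs : 0 < s) {K : ℕ} (hsK : s < K) (hKs : (K : ℝ) - 1 < s) {D : ℝ}
    (hD : 0 < D) :
    ∃ T lam C : ℝ, 1 ≤ T ∧ 0 < lam ∧ lam ≤ 1 ∧
      ∀ (ν : Measure E) [IsFiniteMeasure ν] (x : E) (r : ℝ), 0 < r →
      density s ν x r ^ 2 ≤ 4⁻¹ * density s ν x (T * r) ^ 2 +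
        ENNReal.ofReal D * ((ν (Metric.ball x r))⁻¹ *
          ∫⁻ y in Metric.ball x r, density s ν y (lam * r) ^ 2 ∂ν) +
        ENNReal.ofReal C * ((ν (Metric.ball x r))⁻¹ *
          ∫⁻ y in Metric.ball x r, (∫⁻ t in Ioc r (T * r),
            ‖flux g ν t y‖ₑ ^ 2 * ENNReal.ofReal (t ^ (-2 * s - 1))) ∂ν) := by
  obtain ⟨n, hnK, hnD⟩ := exists_fine_grid hs hKs hD
  have hn : 0 < n := by omega
  have hn' : (0 : ℝ) < n := by exact_mod_cast hn
  obtain ⟨T, c, hT, hc, hlow⟩ := hg.exists_energy_lower_bound E hs hsK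
    (show (0 : ℝ) < 1 / n by positivity)
  refine ⟨T, (K + 1 : ℝ) / n, c⁻¹, hT, by positivity, ?_, ?_⟩
  · rw [div_le_one hn']
    exact_mod_cast hnK
  intro ν _ x r hr
  have hT0 : 0 < T := by linarith
  by_cases hng : ν.real (Metric.ball x (T * r)) ≤ 2 * T ^ s * ν.real (Metric.ball x r)
  swap
  · refine le_trans ?_ (le_add_right (le_add_right le_rfl))
    push Not at hng
    -- The mass grew by more than `2 T^s`, so the density at least doubles; squaring produces the
    -- factor `4⁻¹`.
    have h1 : 2 * density s ν x r ≤ density s ν x (T * r) := by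
      rw [density, density, Real.mul_rpow hT0.le hr.le, ENNReal.ofReal_mul (by positivity),
        ENNReal.le_div_iff_mul_le (Or.inl (by positivity)) (Or.inl (by finiteness))]
      have h2 : ENNReal.ofReal (2 * T ^ s * ν.real (Metric.ball x r)) ≤
          ν (Metric.ball x (T * r)) := by
        rw [← ofReal_measureReal]
        exact ENNReal.ofReal_le_ofReal hng.le
      rw [ENNReal.ofReal_mul (by positivity), ENNReal.ofReal_mul (by norm_num),
        ofReal_measureReal, ENNReal.ofReal_ofNat] at h2
      refine le_trans (le_of_eq ?_) h2
      have h3 : ν (Metric.ball x r) / ENNReal.ofReal (r ^ s) * ENNReal.ofReal (r ^ s) =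
          ν (Metric.ball x r) :=
        ENNReal.div_mul_cancel (by simp; positivity) ENNReal.ofReal_ne_top
      calc _ = 2 * ENNReal.ofReal (T ^ s) * (ν (Metric.ball x r) / ENNReal.ofReal (r ^ s) *
            ENNReal.ofReal (r ^ s)) := by ring
        _ = _ := by rw [h3]
    calc density s ν x r ^ 2 = 4⁻¹ * (2 * density s ν x r) ^ 2 := by
          rw [mul_pow, ← mul_assoc]
          norm_num
          rw [ENNReal.inv_mul_cancel (by norm_num) (by norm_num), one_mul]
      _ ≤ _ := by gcongr
  by_cases hnf : ∀ j < K, ∀ e : Fin j → E, Orthonormal ℝ e → ∀ p : E,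
        2 * ν.real (Metric.ball x r ∩ {y | ‖residual e (y - p)‖ < 1 / n * r}) <
          ν.real (Metric.ball x r)
  swap
  · push Not at hnf
    obtain ⟨j, hj, e, he, p, h⟩ := hnf
    refine le_trans ?_ (le_add_right (le_add_left le_rfl))
    refine (density_sq_le_of_flat ν hr hn hj he p h).trans ?_
    gcongr
  · refine le_trans ?_ (le_add_left le_rfl)
    have h1 := hlow ν x r hr hnf hng
    rcases eq_or_ne (ν (Metric.ball x r)) 0 with h0 | h0
    · rw [density, h0]
      simp
    have hfin : ν (Metric.ball x r) ≠ ⊤ := measure_ne_top _ _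
    have h2 : c * ν.real (Metric.ball x r) ^ 2 / r ^ (2 * s) =
        c * (ν.real (Metric.ball x r) ^ 2 * r ^ (-2 * s)) := by
      rw [neg_mul, Real.rpow_neg hr.le]
      ring
    rw [h2, ENNReal.ofReal_mul hc.le, ENNReal.ofReal_mul (by positivity),
      ENNReal.ofReal_pow measureReal_nonneg, ofReal_measureReal, ← density_sq ν x hr] at h1
    calc density s ν x r ^ 2 = ENNReal.ofReal c⁻¹ * ((ν (Metric.ball x r))⁻¹ *
          (ENNReal.ofReal c * density s ν x r ^ 2 * ν (Metric.ball x r))) := by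
          rw [mul_comm (ν (Metric.ball x r))⁻¹, mul_assoc (ENNReal.ofReal c * _),
            ENNReal.mul_inv_cancel h0 hfin, mul_one, ← mul_assoc,
            ← ENNReal.ofReal_mul (by positivity), inv_mul_cancel₀ hc.ne']
          simp
      _ ≤ _ := by gcongr

end SquareFunction

/-! ### Integration over scales and absorption. -/

namespace SquareFunction

theorem lintegral_Ioi_comp_mul_left {f : ℝ → ℝ≥0∞} (hf : Measurable f) {T : ℝ} (hT : 0 < T) (a : ℝ) :
    ∫⁻ r in Ioi a, f (T * r) / ENNReal.ofReal r =
      ∫⁻ r in Ioi (T * a), f r / ENNReal.ofReal r := by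
  have hm : Measurable fun r : ℝ => f r / ENNReal.ofReal r := hf.div ENNReal.measurable_ofReal
  have h1 := lintegral_map (μ := volume) (hm.indicator (measurableSet_Ioi (a := T * a)))
    (measurable_const_mul T)
  rw [Real.map_volume_mul_left hT.ne', lintegral_smul_measure, smul_eq_mul,
    abs_of_pos (by positivity), lintegral_indicator measurableSet_Ioi] at h1
  have h2 : ENNReal.ofReal T * ENNReal.ofReal T⁻¹ = 1 := by
    rw [← ENNReal.ofReal_mul hT.le, mul_inv_cancel₀ hT.ne', ENNReal.ofReal_one]
  rw [← one_mul (∫⁻ r in Ioi (T * a), f r / ENNReal.ofReal r), ← h2, mul_assoc, h1,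
    ← lintegral_const_mul' _ _ ENNReal.ofReal_ne_top, ← lintegral_indicator measurableSet_Ioi]
  refine lintegral_congr fun r => ?_
  by_cases hr : a < r
  · rw [indicator_of_mem (show r ∈ Ioi a from hr),
      indicator_of_mem (show T * r ∈ Ioi (T * a) from mul_lt_mul_of_pos_left hr hT),
      ENNReal.ofReal_mul hT.le, div_eq_mul_inv, div_eq_mul_inv,
      ENNReal.mul_inv (Or.inl (by simpa using hT)) (Or.inl ENNReal.ofReal_ne_top),
      mul_left_comm, ← mul_assoc (ENNReal.ofReal T),
      ENNReal.mul_inv_cancel (by simpa using hT) ENNReal.ofReal_ne_top, one_mul]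
  · rw [indicator_of_notMem (show r ∉ Ioi a from hr),
      indicator_of_notMem (show T * r ∉ Ioi (T * a) from fun h => hr (lt_of_mul_lt_mul_left h hT.le)),
      mul_zero]

/-- By Tonelli, each `t` is counted for `r ∈ [t/T, t)`. Bounding `1/r` by `T/t` on a set of length
at most `t` gives the factor `T`. -/
theorem lintegral_Ioi_lintegral_Ioc_le {G : ℝ → ℝ≥0∞} (hG : Measurable G) {T a : ℝ} (hT : 1 ≤ T)
    (ha : 0 ≤ a) :
    ∫⁻ r in Ioi a, (∫⁻ t in Ioc r (T * r), G t) / ENNReal.ofReal r ≤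
      ENNReal.ofReal T * ∫⁻ t in Ioi 0, G t := by
  have hs : MeasurableSet {q : ℝ × ℝ | q.1 < q.2 ∧ q.2 ≤ T * q.1} :=
    (measurableSet_lt measurable_fst measurable_snd).inter
      (measurableSet_le measurable_snd (measurable_fst.const_mul T))
  have hm : Measurable ({q : ℝ × ℝ | q.1 < q.2 ∧ q.2 ≤ T * q.1}.indicator
      fun q => G q.2 / ENNReal.ofReal q.1) :=
    ((hG.comp measurable_snd).div (ENNReal.measurable_ofReal.comp measurable_fst)).indicator hs
  calc _ = ∫⁻ r in Ioi a, ∫⁻ t, {q : ℝ × ℝ | q.1 < q.2 ∧ q.2 ≤ T * q.1}.indicator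
          (fun q => G q.2 / ENNReal.ofReal q.1) (r, t) := by
        refine lintegral_congr fun r => ?_
        rw [div_eq_mul_inv, ← lintegral_mul_const _ hG, ← lintegral_indicator measurableSet_Ioc]
        rfl
    _ = ∫⁻ t, ∫⁻ r in Ioi a, {q : ℝ × ℝ | q.1 < q.2 ∧ q.2 ≤ T * q.1}.indicator
          (fun q => G q.2 / ENNReal.ofReal q.1) (r, t) :=
        lintegral_lintegral_swap hm.aemeasurable
    _ ≤ ∫⁻ t, (Ioi 0).indicator (fun t => ENNReal.ofReal T * G t) t := by
        refine lintegral_mono fun t => ?_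
        by_cases ht : 0 < t
        · rw [indicator_of_mem (show t ∈ Ioi 0 from ht)]
          have hT0 : 0 < T := by linarith
          calc _ ≤ ∫⁻ r, (Ioc 0 t).indicator
                (fun _ => G t * (ENNReal.ofReal (t / T))⁻¹) r := by
                refine (lintegral_mono' Measure.restrict_le_self le_rfl).trans
                  (lintegral_mono fun r => ?_)
                by_cases hr : r < t ∧ t ≤ T * r
                · rw [indicator_of_mem (show (r, t) ∈ {q : ℝ × ℝ | q.1 < q.2 ∧ q.2 ≤ T * q.1}
                    from hr)]
                  have hr0 : 0 < r := pos_of_mul_pos_right (ht.trans_le hr.2) hT0.le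
                  rw [indicator_of_mem (show r ∈ Ioc 0 t from ⟨hr0, hr.1.le⟩), div_eq_mul_inv]
                  gcongr
                  rw [div_le_iff₀ hT0, mul_comm]
                  exact hr.2
                · rw [indicator_of_notMem
                    (show (r, t) ∉ {q : ℝ × ℝ | q.1 < q.2 ∧ q.2 ≤ T * q.1} from hr)]
                  exact zero_le
            _ = ENNReal.ofReal T * G t := by
                rw [lintegral_indicator measurableSet_Ioc, setLIntegral_const, Real.volume_Ioc,
                  sub_zero, mul_assoc, mul_comm, ← ENNReal.ofReal_inv_of_pos (by positivity),
                  ← ENNReal.ofReal_mul (by positivity)]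
                congr 2
                field_simp
        · rw [indicator_of_notMem (show t ∉ Ioi 0 from ht), nonpos_iff_eq_zero,
            setLIntegral_congr_fun (g := fun _ => 0) measurableSet_Ioi, lintegral_zero]
          intro r hr
          refine indicator_of_notMem (fun h => ht ?_) _
          exact (ha.trans_lt hr).trans h.1
    _ = _ := by rw [lintegral_indicator measurableSet_Ioi, lintegral_const_mul _ hG]

theorem le_two_mul_of_le_add {V R : ℝ≥0∞} (hV : V ≠ ⊤) (h : V ≤ 4⁻¹ * V + 4⁻¹ * V + R) :
    V ≤ 2 * R := by
  rcases eq_or_ne R ⊤ with hR | hR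
  · rw [hR]
    simp
  · have h1 := ENNReal.toReal_mono (by finiteness) h
    rw [ENNReal.toReal_add (by finiteness) hR, ENNReal.toReal_add (by finiteness) (by finiteness),
      ENNReal.toReal_mul, ENNReal.toReal_inv, ENNReal.toReal_ofNat] at h1
    rw [← ENNReal.toReal_le_toReal hV (by finiteness), ENNReal.toReal_mul, ENNReal.toReal_ofNat]
    linarith

/-- Integration of a pointwise bound over all centres and all scales larger than `a`. -/
theorem lintegral_le_of_pointwise {α : Type*} [MeasurableSpace α] (ν : Measure α)
    [SFinite ν] {a : ℝ} {f₀ f₁ f₂ f₃ : α × ℝ → ℝ≥0∞}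
    (m₁ : Measurable f₁) (m₃ : Measurable f₃) {c₁ c₂ c₃ : ℝ≥0∞}
    (h₁ : c₁ ≠ ⊤) (h₂ : c₂ ≠ ⊤) (h₃ : c₃ ≠ ⊤)
    (h : ∀ x, ∀ r ∈ Ioi a, f₀ (x, r) ≤ c₁ * f₁ (x, r) + c₂ * f₂ (x, r) + c₃ * f₃ (x, r)) :
    ∫⁻ x, (∫⁻ r in Ioi a, f₀ (x, r)) ∂ν ≤ c₁ * ∫⁻ x, (∫⁻ r in Ioi a, f₁ (x, r)) ∂ν +
      c₂ * ∫⁻ x, (∫⁻ r in Ioi a, f₂ (x, r)) ∂ν + c₃ * ∫⁻ x, (∫⁻ r in Ioi a, f₃ (x, r)) ∂ν := by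
  have cross : ∀ {f : α × ℝ → ℝ≥0∞}, Measurable f → ∀ x, Measurable fun r => f (x, r) :=
    fun hf x => hf.comp measurable_prodMk_left
  rw [← lintegral_const_mul' _ _ h₁, ← lintegral_const_mul' _ _ h₂, ← lintegral_const_mul' _ _ h₃,
    ← lintegral_add_left (m₁.lintegral_prod_right'.const_mul _),
    ← lintegral_add_right _ (m₃.lintegral_prod_right'.const_mul _)]
  refine lintegral_mono fun x => ?_
  simp only
  rw [← lintegral_const_mul' _ _ h₁, ← lintegral_const_mul' _ _ h₂, ← lintegral_const_mul' _ _ h₃,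
    ← lintegral_add_left ((cross m₁ x).const_mul _),
    ← lintegral_add_right _ ((cross m₃ x).const_mul _)]
  exact setLIntegral_mono' measurableSet_Ioi (h x)

variable {E : Type*} [NormedAddCommGroup E] [InnerProductSpace ℝ E] [FiniteDimensional ℝ E]
  [MeasurableSpace E] [BorelSpace E]

theorem measurable_density_mul (s : ℝ) (ν : Measure E) [SFinite ν] (b : ℝ) :
    Measurable fun q : E × ℝ => density s ν q.1 (b * q.2) ^ 2 / ENNReal.ofReal q.2 := by
  refine Measurable.div (Measurable.pow_const ?_ 2)
    (ENNReal.measurable_ofReal.comp measurable_snd)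
  exact Measurable.comp (g := fun p : E × ℝ => density s ν p.1 p.2)
    (f := fun q : E × ℝ => (q.1, b * q.2)) (measurable_density s ν)
    (measurable_fst.prodMk (measurable_snd.const_mul b))

theorem measurable_setLIntegral_Ioc {α : Type*} [MeasurableSpace α] {G : α × ℝ → ℝ≥0∞}
    (hG : Measurable G) (T : ℝ) :
    Measurable fun q : α × ℝ => ∫⁻ t in Ioc q.2 (T * q.2), G (q.1, t) := by
  have hs : MeasurableSet {q : (α × ℝ) × ℝ | q.1.2 < q.2 ∧ q.2 ≤ T * q.1.2} :=
    (measurableSet_lt measurable_fst.snd measurable_snd).inter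
      (measurableSet_le measurable_snd (measurable_fst.snd.const_mul T))
  have h1 : Measurable fun q : (α × ℝ) × ℝ => G (q.1.1, q.2) :=
    hG.comp (measurable_fst.fst.prodMk measurable_snd)
  have h2 := (h1.indicator hs).lintegral_prod_right' (ν := volume)
  convert h2 using 1
  ext p
  rw [← lintegral_indicator measurableSet_Ioc]
  rfl

theorem IsProfile.measurable_scale_energy {g : ℝ → ℝ} (hg : IsProfile g) (ν : Measure E)
    [IsFiniteMeasure ν] (s T : ℝ) :
    Measurable fun q : E × ℝ => (∫⁻ t in Ioc q.2 (T * q.2),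
      ‖flux g ν t q.1‖ₑ ^ 2 * ENNReal.ofReal (t ^ (-2 * s - 1))) / ENNReal.ofReal q.2 :=
  (measurable_setLIntegral_Ioc (hg.measurable_energy_density ν s) T).div
    (ENNReal.measurable_ofReal.comp measurable_snd)

theorem measurable_average (ν : Measure E) [SFinite ν] {Φ : E → ℝ → ℝ≥0∞}
    (hΦ : Measurable (Function.uncurry Φ)) : Measurable fun q : E × ℝ =>
      (ν (Metric.ball q.1 q.2))⁻¹ * ∫⁻ y in Metric.ball q.1 q.2, Φ y q.2 ∂ν :=
  (measurable_measure_ball ν).inv.mul (measurable_setLIntegral_ball ν hΦ)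

/-- The Wolff energy of a measure, truncated to scales larger than `a`. -/
noncomputable def truncatedEnergy {E : Type*} [NormedAddCommGroup E] [MeasurableSpace E] (s : ℝ)
    (ν : Measure E) (a : ℝ) : ℝ≥0∞ :=
  ∫⁻ x, (∫⁻ r in Ioi a, density s ν x r ^ 2 / ENNReal.ofReal r) ∂ν

theorem truncatedEnergy_ne_top {E : Type*} [NormedAddCommGroup E] [MeasurableSpace E]
    {s : ℝ} (hs : 0 < s) (ν : Measure E) [IsFiniteMeasure ν] {a : ℝ}
    (ha : 0 < a) : truncatedEnergy s ν a ≠ ⊤ := by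
  have h1 : ∫⁻ r in Ioi a, ENNReal.ofReal (r ^ (-2 * s - 1)) ≠ ⊤ := by
    have h2 : IntegrableOn (fun r : ℝ => r ^ (-2 * s - 1)) (Ioi a) :=
      integrableOn_Ioi_rpow_of_lt (by linarith) ha
    exact h2.lintegral_lt_top.ne
  refine ne_top_of_le_ne_top (b := ν univ ^ 2 *
    (∫⁻ r in Ioi a, ENNReal.ofReal (r ^ (-2 * s - 1))) * ν univ) (by finiteness) ?_
  rw [truncatedEnergy, ← lintegral_const]
  refine lintegral_mono fun x => ?_
  rw [← lintegral_const_mul' _ _ (by finiteness)]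
  refine setLIntegral_mono' measurableSet_Ioi fun r hr => ?_
  have hr : 0 < r := ha.trans hr
  rw [density_sq ν x hr, div_eq_mul_inv, mul_assoc, ← ENNReal.ofReal_inv_of_pos hr,
    ← ENNReal.ofReal_mul (by positivity), Real.rpow_sub_one hr.ne', ← div_eq_mul_inv]
  gcongr
  exact subset_univ _

/-- On the extra scales `(lam * a, a]` the density is at most `A`, so their contribution is bounded
independently of `a`. -/
theorem truncatedEnergy_mul_le {s : ℝ} (ν : Measure E) [IsFiniteMeasure ν] {A : ℝ}
    (hA : ∀ (x : E) (r : ℝ), 0 < r → ν.real (Metric.ball x r) ≤ A * r ^ s) {lam a : ℝ}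
    (hlam : 0 < lam) (hlam1 : lam ≤ 1) (ha : 0 < a) :
    truncatedEnergy s ν (lam * a) ≤
      truncatedEnergy s ν a + ENNReal.ofReal (A ^ 2 / lam) * ν univ := by
  have hd : ∀ x : E, Measurable fun r => density s ν x r ^ 2 / ENNReal.ofReal r := fun x =>
    (((measurable_density s ν).comp (measurable_const.prodMk measurable_id)).pow_const 2).div
      ENNReal.measurable_ofReal
  have hm : Measurable fun x => ∫⁻ r in Ioi a, density s ν x r ^ 2 / ENNReal.ofReal r :=
    (((measurable_density s ν).pow_const 2).div
      (ENNReal.measurable_ofReal.comp measurable_snd)).lintegral_prod_right'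
  rw [truncatedEnergy, truncatedEnergy, ← lintegral_const, ← lintegral_add_left hm]
  refine lintegral_mono fun x => ?_
  have hla : lam * a ≤ a := mul_le_of_le_one_left ha.le hlam1
  rw [← Ioc_union_Ioi_eq_Ioi hla, add_comm]
  refine (lintegral_union_le _ _ _).trans (add_le_add ?_ le_rfl)
  calc _ ≤ ∫⁻ r in Ioc (lam * a) a, ENNReal.ofReal (A ^ 2 / (lam * a)) := by
        refine setLIntegral_mono' measurableSet_Ioc fun r hr => ?_
        have h0 : 0 < lam * a := by positivity
        have hr0 : 0 < r := h0.trans hr.1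
        have h1 := hA x r hr0
        have h2 : density s ν x r ≤ ENNReal.ofReal A := by
          rw [density]
          refine ENNReal.div_le_of_le_mul ?_
          have hA0 : 0 ≤ A := nonneg_of_mul_nonneg_left (measureReal_nonneg.trans h1)
            (by positivity)
          rw [← ENNReal.ofReal_mul hA0, ← ofReal_measureReal]
          exact ENNReal.ofReal_le_ofReal h1
        have hA0 : 0 ≤ A := nonneg_of_mul_nonneg_left (measureReal_nonneg.trans h1)
          (by positivity)
        rw [ENNReal.ofReal_div_of_pos h0, ENNReal.ofReal_pow hA0]
        gcongr
        exact hr.1.le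
    _ = ENNReal.ofReal (A ^ 2 / (lam * a)) * ENNReal.ofReal (a - lam * a) := by
        rw [setLIntegral_const, Real.volume_Ioc]
    _ ≤ ENNReal.ofReal (A ^ 2 / lam) := by
        rw [← ENNReal.ofReal_mul (by positivity)]
        refine ENNReal.ofReal_le_ofReal ?_
        have h3 : A ^ 2 / (lam * a) * (a - lam * a) = A ^ 2 / lam * (1 - lam) := by field_simp
        rw [h3]
        exact mul_le_of_le_one_right (by positivity) (by linarith)

/-- Monotone convergence along the truncations `1/(n+1)`, after exchanging the integrals. -/
theorem truncatedEnergy_zero_le {s : ℝ} (ν : Measure E) [IsFiniteMeasure ν] {R : ℝ≥0∞}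
    (h : ∀ a, 0 < a → truncatedEnergy s ν a ≤ R) : truncatedEnergy s ν 0 ≤ R := by
  have hm : Measurable fun q : E × ℝ => density s ν q.1 q.2 ^ 2 / ENNReal.ofReal q.2 :=
    ((measurable_density s ν).pow_const 2).div (ENNReal.measurable_ofReal.comp measurable_snd)
  have hswap : ∀ a, truncatedEnergy s ν a =
      ∫⁻ r in Ioi a, ∫⁻ x, density s ν x r ^ 2 / ENNReal.ofReal r ∂ν := fun a =>
    lintegral_lintegral_swap hm.aemeasurable
  have hU : Ioi (0 : ℝ) = ⋃ n : ℕ, Ioi (1 / ((n : ℝ) + 1)) := by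
    ext r
    simp only [mem_Ioi, mem_iUnion]
    constructor
    · exact fun hr => exists_nat_one_div_lt hr
    · rintro ⟨n, hn⟩
      exact lt_trans (by positivity) hn
  rw [hswap, hU, setLIntegral_iUnion_of_directed]
  · refine iSup_le fun n => ?_
    rw [← hswap]
    exact h _ (by positivity)
  · refine Monotone.directed_le fun m n hmn => Ioi_subset_Ioi ?_
    exact Nat.one_div_le_one_div hmn

/-- The Wolff energy of a measure of power growth is controlled by its mass and the energy of
its square function. -/
theorem IsProfile.exists_truncatedEnergy_le {g : ℝ → ℝ} (hg : IsProfile g) (E : Type*)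
    [NormedAddCommGroup E] [InnerProductSpace ℝ E] [FiniteDimensional ℝ E] [MeasurableSpace E]
    [BorelSpace E] {s : ℝ} (hs : 0 < s) {K : ℕ} (hsK : s < K) (hKs : (K : ℝ) - 1 < s) (A : ℝ) :
    ∃ C : ℝ≥0, ∀ (ν : Measure E) [IsFiniteMeasure ν],
      (∀ (x : E) (r : ℝ), 0 < r → ν.real (Metric.ball x r) ≤ A * r ^ s) →
      truncatedEnergy s ν 0 ≤ C * (ν univ + energy g s ν) := by
  set N : ℕ := (2 * (Module.finrank ℝ E + 1) + 1) ^ Module.finrank ℝ E with hN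
  have hN0 : 0 < N := by positivity
  -- With `D = 1/(4N)` the averaging constant `N` leaves a quarter of the energy in the small-scale
  -- term. Together with the quarter from the large scale, half can be absorbed.
  obtain ⟨T, lam, C, hT, hlam, hlam1, hpt⟩ := hg.exists_density_sq_le E hs hsK hKs
    (show (0 : ℝ) < 1 / (4 * N) by positivity)
  have hT0 : 0 < T := by linarith
  have hND : (N : ℝ≥0∞) * ENNReal.ofReal (1 / (4 * N)) = 4⁻¹ := by
    rw [← ENNReal.ofReal_natCast, ← ENNReal.ofReal_mul (by positivity)]
    have : (N : ℝ) * (1 / (4 * N)) = 4⁻¹ := by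
      field_simp
    rw [this, ENNReal.ofReal_inv_of_pos (by norm_num), ENNReal.ofReal_ofNat]
  have hfin : 2 * (4⁻¹ * ENNReal.ofReal (A ^ 2 / lam) +
      N * ENNReal.ofReal C * ENNReal.ofReal T) ≠ ⊤ := by finiteness
  refine ⟨(2 * (4⁻¹ * ENNReal.ofReal (A ^ 2 / lam) +
      N * ENNReal.ofReal C * ENNReal.ofReal T)).toNNReal, fun ν _ hA => ?_⟩
  rw [ENNReal.coe_toNNReal hfin]
  refine truncatedEnergy_zero_le ν fun a ha => ?_
  let Ψ : E → ℝ → ℝ≥0∞ := fun y r => (∫⁻ t in Ioc r (T * r),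
    ‖flux g ν t y‖ₑ ^ 2 * ENNReal.ofReal (t ^ (-2 * s - 1))) / ENNReal.ofReal r
  let Θ : E → ℝ → ℝ≥0∞ := fun y r => density s ν y (lam * r) ^ 2 / ENNReal.ofReal r
  have hΨ : Measurable (Function.uncurry Ψ) := hg.measurable_scale_energy ν s T
  have hΘ : Measurable (Function.uncurry Θ) := measurable_density_mul s ν lam
  have hdx : ∀ x : E, Measurable fun r => density s ν x r ^ 2 := fun x =>
    ((measurable_density s ν).comp (measurable_const.prodMk measurable_id)).pow_const 2
  have hshift : ∀ b : ℝ, 0 < b →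
      ∫⁻ x, (∫⁻ r in Ioi a, density s ν x (b * r) ^ 2 / ENNReal.ofReal r) ∂ν =
        truncatedEnergy s ν (b * a) := fun b hb =>
    lintegral_congr fun x => lintegral_Ioi_comp_mul_left (hdx x) hb a
  have hsplit : truncatedEnergy s ν a ≤
      4⁻¹ * truncatedEnergy s ν (T * a) +
      ENNReal.ofReal (1 / (4 * N)) * ∫⁻ x, (∫⁻ r in Ioi a, (ν (Metric.ball x r))⁻¹ *
        ∫⁻ y in Metric.ball x r, Θ y r ∂ν) ∂ν +
      ENNReal.ofReal C * ∫⁻ x, (∫⁻ r in Ioi a, (ν (Metric.ball x r))⁻¹ *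
        ∫⁻ y in Metric.ball x r, Ψ y r ∂ν) ∂ν := by
    rw [← hshift T hT0]
    refine lintegral_le_of_pointwise ν
      (f₀ := fun q => density s ν q.1 q.2 ^ 2 / ENNReal.ofReal q.2)
      (measurable_density_mul s ν T) (measurable_average ν hΨ) (by finiteness) (by finiteness)
      (by finiteness) (f₂ := fun q => (ν (Metric.ball q.1 q.2))⁻¹ *
        ∫⁻ y in Metric.ball q.1 q.2, Θ y q.2 ∂ν) fun x r hr => ?_
    have hr : 0 < r := ha.trans hr
    have hrinv : (ENNReal.ofReal r)⁻¹ ≠ ⊤ := by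
      rw [ENNReal.inv_ne_top]
      simpa using hr
    have h1 := hpt ν x r hr
    simp only [Θ, Ψ, div_eq_mul_inv]
    rw [lintegral_mul_const' _ _ hrinv, lintegral_mul_const' _ _ hrinv]
    refine (mul_le_mul_left h1 _).trans (le_of_eq ?_)
    simp only [div_eq_mul_inv]
    ring
  have hb1 : truncatedEnergy s ν (T * a) ≤ truncatedEnergy s ν a := by
    refine lintegral_mono fun x => lintegral_mono_set (Ioi_subset_Ioi ?_)
    exact le_mul_of_one_le_left ha.le hT
  have hb2 := lintegral_average_ball_le ν ha.le hΘ
  have hb3 := lintegral_average_ball_le ν ha.le hΨ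
  have hb2' : ∫⁻ y, (∫⁻ r in Ioi a, Θ y r) ∂ν ≤
      truncatedEnergy s ν a + ENNReal.ofReal (A ^ 2 / lam) * ν univ :=
    (hshift lam hlam).le.trans (truncatedEnergy_mul_le ν hA hlam hlam1 ha)
  have hb3' : ∫⁻ y, (∫⁻ r in Ioi a, Ψ y r) ∂ν ≤ ENNReal.ofReal T * energy g s ν := by
    rw [energy, ← lintegral_const_mul' _ _ (by finiteness)]
    exact lintegral_mono fun y => lintegral_Ioi_lintegral_Ioc_le
      ((hg.measurable_energy_density ν s).comp measurable_prodMk_left) hT ha.le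
  have hN' : ((2 * (Module.finrank ℝ E + 1) + 1 : ℕ) ^ Module.finrank ℝ E : ℝ≥0∞) = N := by
    rw [hN]
    push_cast
    rfl
  rw [hN'] at hb2 hb3
  have hmain : truncatedEnergy s ν a ≤ 4⁻¹ * truncatedEnergy s ν a +
      4⁻¹ * truncatedEnergy s ν a + (4⁻¹ * (ENNReal.ofReal (A ^ 2 / lam) * ν univ) +
        N * ENNReal.ofReal C * (ENNReal.ofReal T * energy g s ν)) := by
    calc truncatedEnergy s ν a ≤ 4⁻¹ * truncatedEnergy s ν a +
          ENNReal.ofReal (1 / (4 * N)) * (N * (truncatedEnergy s ν a +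
            ENNReal.ofReal (A ^ 2 / lam) * ν univ)) +
          ENNReal.ofReal C * (N * (ENNReal.ofReal T * energy g s ν)) := by
          refine hsplit.trans ?_
          gcongr
          · exact hb2.trans (by gcongr)
          · exact hb3.trans (by gcongr)
      _ = _ := by
          rw [← mul_assoc (ENNReal.ofReal (1 / (4 * N))), mul_comm (ENNReal.ofReal (1 / (4 * N))),
            hND]
          ring
  refine (le_two_mul_of_le_add (truncatedEnergy_ne_top hs ν ha) hmain).trans ?_
  refine le_trans ?_ (mul_assoc 2 _ _).ge
  gcongr
  rw [add_mul, mul_add, mul_add]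
  calc _ = 4⁻¹ * ENNReal.ofReal (A ^ 2 / lam) * ν univ +
        N * ENNReal.ofReal C * ENNReal.ofReal T * energy g s ν := by ring
    _ ≤ _ := add_le_add (le_add_right le_rfl) (le_add_left le_rfl)

/-! ### Cubes and the conclusion. -/

theorem isOpen_cube {d : ℕ} (c : EuclideanSpace ℝ (Fin d)) (ℓ : ℝ) : IsOpen (cube c ℓ) := by
  simp only [cube, ofPred_forall]
  exact isOpen_iInter_of_finite fun i => isOpen_lt (by fun_prop) continuous_const

theorem measure_cube_ne_top {d : ℕ} (μ : Measure (EuclideanSpace ℝ (Fin d)))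
    [IsLocallyFiniteMeasure μ] (c : EuclideanSpace ℝ (Fin d)) (ℓ : ℝ) : μ (cube c ℓ) ≠ ⊤ := by
  have h1 : IsCompact ((EuclideanSpace.equiv (Fin d) ℝ).toHomeomorph ⁻¹'
      Set.univ.pi fun i => Icc (c i - ℓ / 2) (c i + ℓ / 2)) :=
    (Homeomorph.isCompact_preimage _).2 (isCompact_univ_pi fun i => isCompact_Icc)
  refine measure_ne_top_of_subset ?_ h1.measure_lt_top.ne
  intro x hx i _
  have h2 := abs_lt.1 (hx i)
  change x i ∈ _
  exact ⟨by linarith [h2.1], by linarith [h2.2]⟩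

theorem wolffEnergy_eq_truncatedEnergy {d : ℕ} (s : ℝ) (μ : Measure (EuclideanSpace ℝ (Fin d)))
    (Q : Set (EuclideanSpace ℝ (Fin d))) :
    wolffEnergy s μ Q = truncatedEnergy s (μ.restrict Q) 0 := by
  refine lintegral_congr fun x => lintegral_congr fun r => ?_
  rw [density, Measure.restrict_apply Metric.isOpen_ball.measurableSet, inter_comm]

end SquareFunction

theorem theorem1p1 (d : ℕ) (hd : 2 ≤ d) (s : ℝ) (hs0 : 0 < s) (hsd : s < d)
    (hs : ∀ n : ℤ, s ≠ n)
    (φ : ℝ → ℝ) (hφ : SquareFunction.IsBump φ)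
    (μ : Measure (EuclideanSpace ℝ (Fin d))) [IsLocallyFiniteMeasure μ] [NullSingletonClass μ]
    (hS : SquareFunction.SquareFunctionBounded s φ μ) :
    ∃ C : ℝ≥0, 0 < C ∧ ∀ (c : EuclideanSpace ℝ (Fin d)) (ℓ : ℝ), 0 < ℓ →
      SquareFunction.wolffEnergy s μ (SquareFunction.cube c ℓ) ≤
        (C : ℝ≥0∞) * μ (SquareFunction.cube c ℓ) := by
  obtain ⟨M, hM⟩ := hS
  have hg := hφ.isProfile
  obtain ⟨A, -, hA⟩ := hg.exists_growth hs0 (μ := μ) (M := M) fun x r =>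
    SquareFunction.energy_restrict_le hM Metric.isOpen_ball.measurableSet measure_ball_lt_top.ne
  -- The strict inequality is the one place where `s` not being an integer enters.
  have hK1 : s < ⌈s⌉₊ := lt_of_le_of_ne (Nat.le_ceil s) (by exact_mod_cast hs ⌈s⌉₊)
  have hK2 : (⌈s⌉₊ : ℝ) - 1 < s := by linarith [Nat.ceil_lt_add_one hs0.le]
  obtain ⟨C, hC⟩ := hg.exists_truncatedEnergy_le (EuclideanSpace ℝ (Fin d)) hs0 hK1 hK2 A
  refine ⟨C * (1 + M ^ 2) + 1, by positivity, fun c ℓ _ => ?_⟩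
  have hQ := (SquareFunction.isOpen_cube c ℓ).measurableSet
  have hfin := SquareFunction.measure_cube_ne_top μ c ℓ
  have : IsFiniteMeasure (μ.restrict (SquareFunction.cube c ℓ)) :=
    isFiniteMeasure_restrict.2 hfin
  rw [SquareFunction.wolffEnergy_eq_truncatedEnergy]
  refine (hC (μ.restrict (SquareFunction.cube c ℓ)) fun x r hr => ?_).trans ?_
  · refine le_trans ?_ (hA x r hr)
    exact ENNReal.toReal_mono measure_ball_lt_top.ne (Measure.restrict_apply_le _ _)
  · rw [Measure.restrict_apply_univ]
    calc _ ≤ (C : ℝ≥0∞) * (μ (SquareFunction.cube c ℓ) +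
          (M : ℝ≥0∞) ^ 2 * μ (SquareFunction.cube c ℓ)) := by
          gcongr
          exact SquareFunction.energy_restrict_le hM hQ hfin
      _ = (C * (1 + M ^ 2) : ℝ≥0∞) * μ (SquareFunction.cube c ℓ) := by ring
      _ ≤ _ := by
          gcongr
          push_cast
          exact le_add_right le_rfl
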